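/- Let $q>0$ be a real number with $q\neq 1$ and put $[n]=\frac{q^n-q^{-n}}{q-q^{-1}}$. Let $\mathbb{C}[SU_q(2)]$ be the unital $*$-algebra generated by $a,b$ with relations $$ba=q\,ab,\quad b^*a=q\,ab^*,\quad bb^*=b^*b,\quad a^*a+q^2b^*b=1,\quad aa^*+bb^*=1 .$$ As a vector space it is $\bigoplus_{l\in\frac12\mathbb{N}_0}V_l\otimes V_l$, where $V_l$ has basis $|l,m\rangle$, $-l\le m\le l$; write $|l\,m\,n\rangle=|l,m\rangle\otimes|l,n\rangle$. Its completion $L^2(SU_q(2))$ with respect to the Haar state has the orthonormal basis $|l\,m\,n\rangle$ (suitably normalised), on which left multiplication is the $*$-representation determined by $$a\,|l\,m\,n\rangle=q^{\frac{-2l+m+n-1}{2}}\sqrt{\tfrac{[l+m+1][l+n+1]}{[2l+1][2l+2]}}\;|l{+}\tfrac12,m{+}\tfrac12,n{+}\tfrac12\rangle+q^{\frac{2l+m+n+1}{2}}\sqrt{\tfrac{[l-m][l-n]}{[2l][2l+1]}}\;|l{-}\tfrac12,m{+}\tfrac12,n{+}\tfrac12\rangle,$$ $$b\,|l\,m\,n\rangle=q^{\frac{m+n-1}{2}}\sqrt{\tfrac{[l+m+1][l-n+1]}{[2l+1][2l+2]}}\;|l{+}\tfrac12,m{+}\tfrac12,n{-}\tfrac12\rangle-q^{\frac{m+n-1}{2}}\sqrt{\tfrac{[l-m][l+n]}{[2l][2l+1]}}\;|l{-}\tfrac12,m{+}\tfrac12,n{-}\tfrac12\rangle$$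 (terms whose indices are out of range are omitted). Let $\Sigma=\mathbb{C}^2$ with orthonormal basis $|\frac12,\frac12\rangle,|\frac12,-\frac12\rangle$, let $\mathbf{H}=L^2(SU_q(2))\otimes\Sigma$ be the completion of $\mathbb{C}[SU_q(2)]\otimes\Sigma$, and let $\eta$ be the $*$-representation of $\mathbb{C}[SU_q(2)]$ on $\mathbf{H}$ by left multiplication on the first factor. Let $k,e,f$ act on the first index of $|l\,m\,n\rangle$ by $k|l,m\rangle=q^m|l,m\rangle$, $e|l,m\rangle=\sqrt{[l-m][l+m+1]}\,|l,m+1\rangle$, $f|l,m\rangle=\sqrt{[l-m+1][l+m]}\,|l,m-1\rangle$, put $Z_1=k^{-1}e$, $Z_0=[2]^{-1/2}(q^{-1}fe-q\,ef)$, $Z_{-1}=-k^{-1}f$, let $\psi_1,\psi_0,\psi_{-1}$ act on $\Sigma$ by $$\psi_1=\begin{pmatrix}0&\sqrt q\\0&0\end{pmatrix},\quad \psi_0=-\frac1{\sqrt{[2]}}\begin{pmatrix}q^{-1}&0\\0&-q\end{pmatrix},\quad \psi_{-1}=\begin{pmatrix}0&0\\-\sqrt{q^{-1}}&0\end{pmatrix},$$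 and let $D$ be the Dirac operator $$D=-q[2]\,Z_1\otimes\psi_{-1}+[2]\,Z_0\otimes\psi_0-q^{-1}[2]\,Z_{-1}\otimes\psi_1$$ on the dense subspace $\mathbb{C}[SU_q(2)]\otimes\Sigma\subset\mathbf{H}$. Then $F=D(1+D^2)^{-1/2}$ (formed with the closure of $D$) is a well-defined bounded operator on $\mathbf{H}$, and $(\mathbb{C}[SU_q(2)],F,\mathbf{H})$ is a $1$-summable Fredholm module: $F$ is self-adjoint, $F^2-1$ is trace class, and $[F,\eta(x)]$ is trace class for every $x\in\mathbb{C}[SU_q(2)]$. -/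

import Mathlib

open scoped InnerProductSpace TensorProduct

namespace SUq2

/-! ### The coordinate algebra of the quantum group -/

/-- The generators `a`, `b`, `a*`, `b*`. -/
inductive Gen : Type
  | a | b | aStar | bStar

/-- The involution on generators. -/
def Gen.conj : Gen → Gen
  | .a => .aStar | .b => .bStar | .aStar => .a | .bStar => .b

/-- The defining relations of `ℂ[SU_q(2)]`:
`b a = q a b`, `b* a = q a b*`, `b b* = b* b`, `a* a + q² b* b = 1`, `a a* + b b* = 1`,
together with the adjoints of the first two. -/
inductive Rel (q : ℝ) : FreeAlgebra ℂ Gen → FreeAlgebra ℂ Gen → Prop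
  | ba : Rel q (FreeAlgebra.ι ℂ .b * FreeAlgebra.ι ℂ .a)
      ((q : ℂ) • (FreeAlgebra.ι ℂ .a * FreeAlgebra.ι ℂ .b))
  | bSa : Rel q (FreeAlgebra.ι ℂ .bStar * FreeAlgebra.ι ℂ .a)
      ((q : ℂ) • (FreeAlgebra.ι ℂ .a * FreeAlgebra.ι ℂ .bStar))
  | aSbS : Rel q (FreeAlgebra.ι ℂ .aStar * FreeAlgebra.ι ℂ .bStar)
      ((q : ℂ) • (FreeAlgebra.ι ℂ .bStar * FreeAlgebra.ι ℂ .aStar))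
  | aSb : Rel q (FreeAlgebra.ι ℂ .aStar * FreeAlgebra.ι ℂ .b)
      ((q : ℂ) • (FreeAlgebra.ι ℂ .b * FreeAlgebra.ι ℂ .aStar))
  | bbS : Rel q (FreeAlgebra.ι ℂ .b * FreeAlgebra.ι ℂ .bStar)
      (FreeAlgebra.ι ℂ .bStar * FreeAlgebra.ι ℂ .b)
  | aSa : Rel q (FreeAlgebra.ι ℂ .aStar * FreeAlgebra.ι ℂ .a
      + ((q : ℂ) ^ 2) • (FreeAlgebra.ι ℂ .bStar * FreeAlgebra.ι ℂ .b)) 1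
  | aaS : Rel q (FreeAlgebra.ι ℂ .a * FreeAlgebra.ι ℂ .aStar
      + FreeAlgebra.ι ℂ .b * FreeAlgebra.ι ℂ .bStar) 1

/-- The polynomial algebra `ℂ[SU_q(2)]`, by generators and relations. -/
abbrev Alg (q : ℝ) : Type := RingQuot (Rel q)

/-- The image of a generator in `ℂ[SU_q(2)]`. -/
noncomputable def gen (q : ℝ) (g : Gen) : Alg q :=
  RingQuot.mkAlgHom ℂ (Rel q) (FreeAlgebra.ι ℂ g)

/-- The opposite algebra with conjugated scalars: algebra homomorphisms into it are
conjugate-linear anti-homomorphisms. Used to define the involution of `ℂ[SU_q(2)]`. -/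
def ConjOp (B : Type) : Type := Bᵐᵒᵖ

instance (B : Type) [Ring B] : Ring (ConjOp B) := inferInstanceAs (Ring Bᵐᵒᵖ)

noncomputable instance (B : Type) [Ring B] [Algebra ℂ B] : Algebra ℂ (ConjOp B) :=
  RingHom.toAlgebra' ((algebraMap ℂ Bᵐᵒᵖ).comp (starRingEnd ℂ))
    (fun c x => Algebra.commutes (A := Bᵐᵒᵖ) (starRingEnd ℂ c) x)

/-- The identity map onto the conjugate opposite algebra. -/
def ConjOp.of {B : Type} (x : B) : ConjOp B := MulOpposite.op x

/-- The identity map from the conjugate opposite algebra. -/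
def ConjOp.un {B : Type} (x : ConjOp B) : B := MulOpposite.unop x

section ConjOp
set_option linter.unusedSectionVars false
variable {B : Type} [Ring B] [Algebra ℂ B]

theorem ConjOp.of_smul (c : ℂ) (x : B) : c • of x = of ((starRingEnd ℂ c) • x) := by
  rw [Algebra.smul_def, Algebra.smul_def, Algebra.commutes]
  rfl

theorem ConjOp.of_mul (x y : B) : of x * of y = of (y * x) := rfl

theorem ConjOp.of_add (x y : B) : of x + of y = of (x + y) := rfl

theorem ConjOp.of_one : (1 : ConjOp B) = of 1 := rfl

end ConjOp

/-- The involution, on the free algebra. -/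
noncomputable def preStar (q : ℝ) : FreeAlgebra ℂ Gen →ₐ[ℂ] ConjOp (Alg q) :=
  FreeAlgebra.lift ℂ (fun g => ConjOp.of (gen q g.conj))

theorem gen_rel {q : ℝ} {x y : FreeAlgebra ℂ Gen} (h : Rel q x y) :
    RingQuot.mkAlgHom ℂ (Rel q) x = RingQuot.mkAlgHom ℂ (Rel q) y :=
  RingQuot.mkAlgHom_rel ℂ h

theorem preStar_ι (q : ℝ) (g : Gen) :
    preStar q (FreeAlgebra.ι ℂ g) = ConjOp.of (gen q g.conj) :=
  FreeAlgebra.lift_ι_apply _ _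

theorem preStar_rel (q : ℝ) ⦃x y : FreeAlgebra ℂ Gen⦄ (h : Rel q x y) :
    preStar q x = preStar q y := by
  have r := @gen_rel q
  cases h <;> simp only [map_mul, map_smul, map_add, map_one, preStar_ι, ConjOp.of_mul,
    ConjOp.of_smul, ConjOp.of_add, ConjOp.of_one, Gen.conj, map_pow, Complex.conj_ofReal] <;>
    apply congrArg ConjOp.of <;> simp only [gen, ← map_mul, ← map_smul, ← map_add]
  · exact r Rel.aSbS
  · exact r Rel.aSb
  · exact r Rel.ba
  · exact r Rel.bSa
  · exact r Rel.bbS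
  · exact (r Rel.aSa).trans (map_one _)
  · exact (r Rel.aaS).trans (map_one _)

/-- The involution of `ℂ[SU_q(2)]`, as a homomorphism into the conjugate opposite algebra. -/
noncomputable def starHom (q : ℝ) : Alg q →ₐ[ℂ] ConjOp (Alg q) :=
  RingQuot.liftAlgHom ℂ ⟨preStar q, preStar_rel q⟩

/-- The involution of `ℂ[SU_q(2)]`, exchanging `a`, `a*` and `b`, `b*`. -/
noncomputable instance (q : ℝ) : Star (Alg q) := ⟨fun x => (starHom q x).un⟩

theorem star_gen (q : ℝ) (g : Gen) : star (gen q g) = gen q g.conj := by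
  change (starHom q (gen q g)).un = _
  rw [starHom, gen, RingQuot.liftAlgHom_mkAlgHom_apply, preStar_ι]
  rfl

theorem alg_star_smul (q : ℝ) (c : ℂ) (x : Alg q) :
    star (c • x) = (starRingEnd ℂ c) • star x := by
  change (starHom q (c • x)).un = _
  rw [map_smul]
  exact congrArg ConjOp.un (ConjOp.of_smul c (starHom q x).un)

theorem alg_star_mul (q : ℝ) (x y : Alg q) : star (x * y) = star y * star x := by
  change (starHom q (x * y)).un = _
  rw [map_mul]
  rfl

theorem alg_star_add (q : ℝ) (x y : Alg q) : star (x + y) = star x + star y := by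
  change (starHom q (x + y)).un = _
  rw [map_add]
  rfl

theorem alg_star_one (q : ℝ) : star (1 : Alg q) = 1 := by
  change (starHom q 1).un = _
  rw [map_one]
  rfl

theorem alg_induction {q : ℝ} {p : Alg q → Prop} (h1 : p 1) (hg : ∀ g, p (gen q g))
    (hs : ∀ (c : ℂ) x, p x → p (c • x)) (hm : ∀ x y, p x → p y → p (x * y))
    (ha : ∀ x y, p x → p y → p (x + y)) (x : Alg q) : p x := by
  obtain ⟨y, rfl⟩ := RingQuot.mkAlgHom_surjective ℂ (Rel q) x
  induction y using FreeAlgebra.induction with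
  | grade0 r => rw [AlgHom.commutes, Algebra.algebraMap_eq_smul_one]; exact hs _ _ h1
  | grade1 g => exact hg g
  | mul a b iha ihb => rw [map_mul]; exact hm _ _ iha ihb
  | add a b iha ihb => rw [map_add]; exact ha _ _ iha ihb

noncomputable instance (q : ℝ) : StarRing (Alg q) where
  star_involutive x := by
    induction x using alg_induction with
    | h1 => simp only [alg_star_one]
    | hg g => simp only [star_gen]; cases g <;> rfl
    | hs c x h => rw [alg_star_smul, alg_star_smul, h, Complex.conj_conj]
    | hm x y hx hy => simp only [alg_star_mul, hx, hy]
    | ha x y hx hy => simp only [alg_star_add, hx, hy]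
  star_mul := alg_star_mul q
  star_add := alg_star_add q

instance (q : ℝ) : StarModule ℂ (Alg q) := ⟨alg_star_smul q⟩
/-! ### The left regular representation -/

/-- The `q`-integer `[n] = (qⁿ - q⁻ⁿ) / (q - q⁻¹)`. -/
noncomputable def qInt (q : ℝ) (n : ℤ) : ℝ := (q ^ n - q ^ (-n)) / (q - q⁻¹)

/-- Index set of the Peter-Weyl basis `|l m n⟩ = |l, m⟩ ⊗ |l, n⟩` of
`ℂ[SU_q(2)] = ⨁ V_l ⊗ V_l`, with `l ∈ ½ℕ₀`, `m, n ∈ {-l, …, l}`, in the integer coordinates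
`N = 2 l`, `i = l + m`, `r = l + n`. -/
@[ext] structure Idx : Type where
  N : ℤ
  i : ℤ
  r : ℤ
  hi : 0 ≤ i ∧ i ≤ N
  hr : 0 ≤ r ∧ r ≤ N
  deriving DecidableEq

/-- The vector space `⨁_l V_l ⊗ V_l` underlying `ℂ[SU_q(2)]`, with basis `|l m n⟩`. -/
abbrev Pol : Type := Idx →₀ ℂ

open Classical in
/-- The vector `|l m n⟩`, where `N = 2 l`, `i = l + m`, `r = l + n`
(zero if the indices are out of range). -/
noncomputable def ket (N i r : ℤ) : Pol :=
  if h : (0 ≤ i ∧ i ≤ N) ∧ (0 ≤ r ∧ r ≤ N) then Finsupp.single ⟨N, i, r, h.1, h.2⟩ 1 else 0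

/-- The number `q ^ (e / 2) * ([x] [y] / ([d] [d + 1])) ^ (1 / 2)`. -/
noncomputable def cf (q : ℝ) (e x y d : ℤ) : ℝ :=
  √q ^ e * √(qInt q x * qInt q y / (qInt q d * qInt q (d + 1)))

/-- `A⁺ = q^{(-2l+m+n-1)/2} ([l+m+1][l+n+1] / ([2l+1][2l+2]))^{1/2}`. -/
noncomputable def aUp (q : ℝ) (N i r : ℤ) : ℝ := cf q (i + r - 2 * N - 1) (i + 1) (r + 1) (N + 1)

/-- `A⁻ = q^{(2l+m+n+1)/2} ([l-m][l-n] / ([2l][2l+1]))^{1/2}`. -/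
noncomputable def aDn (q : ℝ) (N i r : ℤ) : ℝ := cf q (i + r + 1) (N - i) (N - r) N

/-- `B⁺ = q^{(m+n-1)/2} ([l+m+1][l-n+1] / ([2l+1][2l+2]))^{1/2}`. -/
noncomputable def bUp (q : ℝ) (N i r : ℤ) : ℝ := cf q (i + r - N - 1) (i + 1) (N - r + 1) (N + 1)

/-- `B⁻ = -q^{(m+n-1)/2} ([l-m][l+n] / ([2l][2l+1]))^{1/2}`. -/
noncomputable def bDn (q : ℝ) (N i r : ℤ) : ℝ := -cf q (i + r - N - 1) (N - i) r N

/-- Left multiplication by `a` in the orthonormal basis: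
`a |l m n⟩ = A⁺ |l+½, m+½, n+½⟩ + A⁻ |l-½, m+½, n+½⟩`. -/
noncomputable def mulA (q : ℝ) : Pol →ₗ[ℂ] Pol :=
  Finsupp.linearCombination ℂ fun p : Idx =>
    (aUp q p.N p.i p.r : ℂ) • ket (p.N + 1) (p.i + 1) (p.r + 1)
      + (aDn q p.N p.i p.r : ℂ) • ket (p.N - 1) p.i p.r

/-- Left multiplication by `b` in the orthonormal basis:
`b |l m n⟩ = B⁺ |l+½, m+½, n-½⟩ + B⁻ |l-½, m+½, n-½⟩`. -/
noncomputable def mulB (q : ℝ) : Pol →ₗ[ℂ] Pol :=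
  Finsupp.linearCombination ℂ fun p : Idx =>
    (bUp q p.N p.i p.r : ℂ) • ket (p.N + 1) (p.i + 1) p.r
      + (bDn q p.N p.i p.r : ℂ) • ket (p.N - 1) p.i (p.r - 1)

/-- The formal adjoint of `mulA`. -/
noncomputable def mulA' (q : ℝ) : Pol →ₗ[ℂ] Pol :=
  Finsupp.linearCombination ℂ fun p : Idx =>
    (aUp q (p.N - 1) (p.i - 1) (p.r - 1) : ℂ) • ket (p.N - 1) (p.i - 1) (p.r - 1)
      + (aDn q (p.N + 1) p.i p.r : ℂ) • ket (p.N + 1) p.i p.r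

/-- The formal adjoint of `mulB`. -/
noncomputable def mulB' (q : ℝ) : Pol →ₗ[ℂ] Pol :=
  Finsupp.linearCombination ℂ fun p : Idx =>
    (bUp q (p.N - 1) (p.i - 1) p.r : ℂ) • ket (p.N - 1) (p.i - 1) p.r
      + (bDn q (p.N + 1) p.i (p.r + 1) : ℂ) • ket (p.N + 1) p.i (p.r + 1)

/-- `(N, i, r)` are the coordinates of a basis vector. -/
def Lawful (N i r : ℤ) : Prop := (0 ≤ i ∧ i ≤ N) ∧ (0 ≤ r ∧ r ≤ N)

theorem ket_of (p : Idx) : Finsupp.single p (1:ℂ) = ket p.N p.i p.r := by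
  rw [ket, dif_pos ⟨p.hi, p.hr⟩]

theorem ket_lawful {N i r : ℤ} (h : Lawful N i r) :
    ket N i r = Finsupp.single ⟨N, i, r, h.1, h.2⟩ 1 := dif_pos h

section ketlemmas
variable {q : ℝ} {N i r : ℤ}

theorem mulA_ket (c : ℝ) (h : c = 0 ∨ Lawful N i r) : mulA q ((c : ℂ) • ket N i r)
    = ((c * aUp q N i r : ℝ) : ℂ) • ket (N + 1) (i + 1) (r + 1)
      + ((c * aDn q N i r : ℝ) : ℂ) • ket (N - 1) i r := by
  rcases h with rfl | h
  · simp
  · rw [ket_lawful h, map_smul, mulA, Finsupp.linearCombination_single, one_smul, smul_add,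
      smul_smul, smul_smul, ← Complex.ofReal_mul, ← Complex.ofReal_mul]

theorem mulB_ket (c : ℝ) (h : c = 0 ∨ Lawful N i r) : mulB q ((c : ℂ) • ket N i r)
    = ((c * bUp q N i r : ℝ) : ℂ) • ket (N + 1) (i + 1) r
      + ((c * bDn q N i r : ℝ) : ℂ) • ket (N - 1) i (r - 1) := by
  rcases h with rfl | h
  · simp
  · rw [ket_lawful h, map_smul, mulB, Finsupp.linearCombination_single, one_smul, smul_add,
      smul_smul, smul_smul, ← Complex.ofReal_mul, ← Complex.ofReal_mul]

theorem mulA'_ket (c : ℝ) (h : c = 0 ∨ Lawful N i r) : mulA' q ((c : ℂ) • ket N i r)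
    = ((c * aUp q (N - 1) (i - 1) (r - 1) : ℝ) : ℂ) • ket (N - 1) (i - 1) (r - 1)
      + ((c * aDn q (N + 1) i r : ℝ) : ℂ) • ket (N + 1) i r := by
  rcases h with rfl | h
  · simp
  · rw [ket_lawful h, map_smul, mulA', Finsupp.linearCombination_single, one_smul, smul_add,
      smul_smul, smul_smul, ← Complex.ofReal_mul, ← Complex.ofReal_mul]

theorem mulB'_ket (c : ℝ) (h : c = 0 ∨ Lawful N i r) : mulB' q ((c : ℂ) • ket N i r)
    = ((c * bUp q (N - 1) (i - 1) r : ℝ) : ℂ) • ket (N - 1) (i - 1) r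
      + ((c * bDn q (N + 1) i (r + 1) : ℝ) : ℂ) • ket (N + 1) i (r + 1) := by
  rcases h with rfl | h
  · simp
  · rw [ket_lawful h, map_smul, mulB', Finsupp.linearCombination_single, one_smul, smul_add,
      smul_smul, smul_smul, ← Complex.ofReal_mul, ← Complex.ofReal_mul]

end ketlemmas

theorem qInt_zero (q : ℝ) : qInt q 0 = 0 := by simp [qInt]

theorem qInt_pos {q : ℝ} (h0 : 0 < q) (h1 : q ≠ 1) {n : ℤ} (hn : 0 < n) : 0 < qInt q n := by
  rw [qInt]
  rcases lt_or_gt_of_ne h1 with h | h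
  · have h2 : 1 < q⁻¹ := (one_lt_inv₀ h0).2 h
    apply div_pos_of_neg_of_neg
    · have : q ^ n < q ^ (-n) := zpow_lt_zpow_right_of_lt_one₀ h0 h (by omega)
      linarith
    · linarith
  · have h2 : q⁻¹ < 1 := inv_lt_one_of_one_lt₀ h
    apply div_pos
    · have : q ^ (-n) < q ^ n := zpow_lt_zpow_right₀ h (by omega)
      linarith
    · linarith

theorem qInt_nonneg {q : ℝ} (h0 : 0 < q) (h1 : q ≠ 1) {n : ℤ} (hn : 0 ≤ n) : 0 ≤ qInt q n := by
  rcases hn.eq_or_lt with rfl | h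
  · rw [qInt_zero]
  · exact (qInt_pos h0 h1 h).le

theorem qInt_eq {q : ℝ} (h0 : 0 < q) (n : ℤ) :
    qInt q n = ((√q ^ n) ^ 2 - ((√q ^ n) ^ 2)⁻¹) / (√q ^ 2 - (√q ^ 2)⁻¹) := by
  have h : (√q ^ n) ^ 2 = q ^ n := by
    rw [← zpow_natCast, ← zpow_mul, mul_comm, zpow_mul, zpow_natCast, Real.sq_sqrt h0.le]
  rw [qInt, h, Real.sq_sqrt h0.le, zpow_neg]

theorem cf_comm (q : ℝ) (e x y d : ℤ) : cf q e x y d = cf q e y x d := by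
  rw [cf, cf, mul_comm (qInt q x)]

/-! Identities between the coefficients, which amount to the defining relations. -/

section coeff
set_option linter.unusedSimpArgs false
set_option linter.unusedSectionVars false
variable {q : ℝ} {N i r : ℤ}

theorem w_ne (h0 : 0 < q) (h1 : q ≠ 1) : √q ^ 2 - (√q ^ 2)⁻¹ ≠ 0 := by
  rw [Real.sq_sqrt h0.le]
  rcases lt_or_gt_of_ne h1 with h | h
  · have := (one_lt_inv₀ h0).2 h
    linarith
  · have := inv_lt_one_of_one_lt₀ h
    linarith

theorem ratio_nonneg (h0 : 0 < q) (h1 : q ≠ 1) {x y d : ℤ} (h : 0 ≤ x ∧ 0 ≤ y ∧ 0 ≤ d) :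
    0 ≤ qInt q x * qInt q y / (qInt q d * qInt q (d + 1)) :=
  have P := fun n hn => @qInt_nonneg q h0 h1 n hn
  div_nonneg (mul_nonneg (P x h.1) (P y h.2.1))
    (mul_nonneg (P d h.2.2) (P (d + 1) (by omega)))

/-- The product of two coefficients. -/
theorem cf_mul (h0 : 0 < q) (h1 : q ≠ 1) {e f x y z w d d' : ℤ} (h : 0 ≤ x ∧ 0 ≤ y ∧ 0 ≤ d) :
    cf q e x y d * cf q f z w d' = √q ^ (e + f) *
      √(qInt q x * qInt q y * qInt q z * qInt q w /
        (qInt q d * qInt q (d + 1) * qInt q d' * qInt q (d' + 1))) := by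
  rw [cf, cf, mul_mul_mul_comm, ← zpow_add₀ (Real.sqrt_pos.2 h0).ne',
    ← Real.sqrt_mul (ratio_nonneg h0 h1 h)]
  congr 2
  ring

/-- The square of a coefficient. -/
theorem cf_sq (h0 : 0 < q) (h1 : q ≠ 1) {e x y d' : ℤ} (d : ℤ) (hd : d' = d) (h : 0 ≤ x ∧ 0 ≤ y ∧ 0 ≤ d) :
    cf q e x y d' * cf q e x y d'
      = √q ^ (e + e) * (qInt q x * qInt q y / (qInt q d * qInt q (d + 1))) := by
  rw [hd, cf, mul_mul_mul_comm, ← zpow_add₀ (Real.sqrt_pos.2 h0).ne',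
    Real.mul_self_sqrt (ratio_nonneg h0 h1 h)]

theorem q_cf (h0 : 0 < q) (e x y d : ℤ) : q * cf q e x y d = cf q (e + 2) x y d := by
  rw [cf, cf, zpow_add₀ (Real.sqrt_pos.2 h0).ne', zpow_ofNat, Real.sq_sqrt h0.le]
  ring

/-- The product of two coefficients with a common factor. -/
theorem cf_common (h0 : 0 < q) (h1 : q ≠ 1) (x y d : ℤ) {e f x' y' u u' d' d'' : ℤ} (hu : u' = u)
    (hd : d' = d ∧ d'' = d) (hx : x' = x ∧ y' = y ∨ x' = y ∧ y' = x)
    (h : 0 ≤ x ∧ 0 ≤ y ∧ 0 ≤ u ∧ 0 ≤ d) :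
    cf q e x' u d' * cf q f y' u' d'' = √(qInt q x * qInt q y) *
      (√q ^ (e + f) * (qInt q u / (qInt q d * qInt q (d + 1)))) := by
  have P := fun n hn => @qInt_nonneg q h0 h1 n hn
  have hxy : qInt q x' * qInt q y' = qInt q x * qInt q y := by
    rcases hx with ⟨rfl, rfl⟩ | ⟨rfl, rfl⟩
    · rfl
    · exact mul_comm _ _
  have hD : 0 ≤ qInt q u / (qInt q d * qInt q (d + 1)) :=
    div_nonneg (P u (by omega)) (mul_nonneg (P d (by omega)) (P (d + 1) (by omega)))
  rw [cf_mul h0 h1 (by omega), hd.1, hd.2, hu, show qInt q x' * qInt q u * qInt q y' * qInt q u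
      / (qInt q d * qInt q (d + 1) * qInt q d * qInt q (d + 1))
      = (qInt q x' * qInt q y') * (qInt q u / (qInt q d * qInt q (d + 1))) ^ 2 by ring, hxy,
    Real.sqrt_mul (mul_nonneg (P x (by omega)) (P y (by omega))), Real.sqrt_sq hD]
  ring

theorem ba_top (h0 : 0 < q) (h1 : q ≠ 1) (h : Lawful N i r) :
    aUp q N i r * bUp q (N + 1) (i + 1) (r + 1)
      = q * (bUp q N i r * aUp q (N + 1) (i + 1) r) := by
  obtain ⟨⟨hi, hiN⟩, hr, hrN⟩ := h
  simp only [aUp, aDn, bUp, bDn, neg_mul, mul_neg]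
  rw [← mul_assoc q, q_cf h0, cf_mul h0 h1 (by omega), cf_mul h0 h1 (by omega)]
  ring_nf

theorem ba_bot (h0 : 0 < q) (h1 : q ≠ 1) (h : Lawful N i r) :
    aDn q N i r * bDn q (N - 1) i r = q * (bDn q N i r * aDn q (N - 1) i (r - 1)) := by
  obtain ⟨⟨hi, hiN⟩, hr, hrN⟩ := h
  simp only [aUp, aDn, bUp, bDn, neg_mul, mul_neg]
  rw [← mul_assoc q, q_cf h0, cf_mul h0 h1 (by omega), cf_mul h0 h1 (by omega)]
  ring_nf

theorem bsa_top (h0 : 0 < q) (h1 : q ≠ 1) (h : Lawful N i r) :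
    aUp q N i r * bDn q (N + 2) (i + 1) (r + 2)
      = q * (bDn q (N + 1) i (r + 1) * aUp q (N + 1) i (r + 1)) := by
  obtain ⟨⟨hi, hiN⟩, hr, hrN⟩ := h
  simp only [aUp, aDn, bUp, bDn, neg_mul, mul_neg]
  rw [← mul_assoc q, q_cf h0, cf_mul h0 h1 (by omega), cf_mul h0 h1 (by omega)]
  ring_nf

theorem bsa_bot (h0 : 0 < q) (h1 : q ≠ 1) (h : Lawful N i r) :
    aDn q N i r * bUp q (N - 2) (i - 1) r
      = q * (bUp q (N - 1) (i - 1) r * aDn q (N - 1) (i - 1) r) := by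
  obtain ⟨⟨hi, hiN⟩, hr, hrN⟩ := h
  simp only [aUp, aDn, bUp, bDn, neg_mul, mul_neg]
  rw [← mul_assoc q, q_cf h0, cf_mul h0 h1 (by omega), cf_mul h0 h1 (by omega)]
  ring_nf

theorem bbs_top (h0 : 0 < q) (h1 : q ≠ 1) (h : Lawful N i r) :
    bDn q (N + 1) i (r + 1) * bUp q (N + 1) i (r + 1)
      = bUp q N i r * bDn q (N + 2) (i + 1) (r + 1) := by
  obtain ⟨⟨hi, hiN⟩, hr, hrN⟩ := h
  simp only [aUp, aDn, bUp, bDn, neg_mul, mul_neg]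
  rw [cf_mul h0 h1 (by omega), cf_mul h0 h1 (by omega)]
  ring_nf

theorem bbs_bot (h0 : 0 < q) (h1 : q ≠ 1) (h : Lawful N i r) :
    bUp q (N - 1) (i - 1) r * bDn q (N - 1) (i - 1) r
      = bDn q N i r * bUp q (N - 2) (i - 1) (r - 1) := by
  obtain ⟨⟨hi, hiN⟩, hr, hrN⟩ := h
  simp only [aUp, aDn, bUp, bDn, neg_mul, mul_neg]
  rw [cf_mul h0 h1 (by omega), cf_mul h0 h1 (by omega)]
  ring_nf

theorem asa_top (h0 : 0 < q) (h1 : q ≠ 1) (h : Lawful N i r) :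
    aUp q N i r * aDn q (N + 2) (i + 1) (r + 1)
      + q ^ 2 * (bUp q N i r * bDn q (N + 2) (i + 1) (r + 1)) = 0 := by
  obtain ⟨⟨hi, hiN⟩, hr, hrN⟩ := h
  simp only [aUp, aDn, bUp, bDn, neg_mul, mul_neg]
  rw [pow_two, mul_mul_mul_comm, q_cf h0, q_cf h0, cf_mul h0 h1 (by omega), cf_mul h0 h1 (by omega)]
  ring_nf

theorem asa_bot (h0 : 0 < q) (h1 : q ≠ 1) (h : Lawful N i r) :
    aDn q N i r * aUp q (N - 2) (i - 1) (r - 1)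
      + q ^ 2 * (bDn q N i r * bUp q (N - 2) (i - 1) (r - 1)) = 0 := by
  obtain ⟨⟨hi, hiN⟩, hr, hrN⟩ := h
  simp only [aUp, aDn, bUp, bDn, neg_mul, mul_neg]
  rw [pow_two, mul_mul_mul_comm, q_cf h0, q_cf h0, cf_mul h0 h1 (by omega), cf_mul h0 h1 (by omega)]
  ring_nf

theorem aas_top (h0 : 0 < q) (h1 : q ≠ 1) (h : Lawful N i r) :
    aDn q (N + 1) i r * aUp q (N + 1) i r
      + bDn q (N + 1) i (r + 1) * bUp q (N + 1) i (r + 1) = 0 := by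
  obtain ⟨⟨hi, hiN⟩, hr, hrN⟩ := h
  simp only [aUp, aDn, bUp, bDn, neg_mul, mul_neg]
  rw [cf_mul h0 h1 (by omega), cf_mul h0 h1 (by omega)]
  ring_nf

theorem aas_bot (h0 : 0 < q) (h1 : q ≠ 1) (h : Lawful N i r) :
    aUp q (N - 1) (i - 1) (r - 1) * aDn q (N - 1) (i - 1) (r - 1)
      + bUp q (N - 1) (i - 1) r * bDn q (N - 1) (i - 1) r = 0 := by
  obtain ⟨⟨hi, hiN⟩, hr, hrN⟩ := h
  simp only [aUp, aDn, bUp, bDn, neg_mul, mul_neg]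
  rw [cf_mul h0 h1 (by omega), cf_mul h0 h1 (by omega)]
  ring_nf

theorem ba_mid (h0 : 0 < q) (h1 : q ≠ 1) (h : Lawful N i r) (h' : i + 1 ≤ N) :
    aUp q N i r * bDn q (N + 1) (i + 1) (r + 1) + aDn q N i r * bUp q (N - 1) i r
      = q * (bUp q N i r * aDn q (N + 1) (i + 1) r + bDn q N i r * aUp q (N - 1) i (r - 1)) := by
  obtain ⟨⟨hi, hiN⟩, hr, hrN⟩ := h
  have hQ := (Real.sqrt_pos.2 h0).ne'
  have n0 := (@qInt_pos q h0 h1 N (by omega)).ne'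
  have n1 := (@qInt_pos q h0 h1 (N + 1) (by omega)).ne'
  have n2 := (@qInt_pos q h0 h1 (N + 1 + 1) (by omega)).ne'
  simp only [aUp, aDn, bUp, bDn, neg_mul, mul_neg]
  rw [mul_add]
  simp only [mul_neg, ← mul_assoc q, q_cf h0]
  rw [cf_common h0 h1 (i + 1) (N - i) (N + 1) (by omega) (by omega) (by omega) (by omega),
    cf_common h0 h1 (i + 1) (N - i) (N) (by omega) (by omega) (by omega) (by omega),
    cf_common h0 h1 (i + 1) (N - i) (N + 1) (by omega) (by omega) (by omega) (by omega),
    cf_common h0 h1 (i + 1) (N - i) (N) (by omega) (by omega) (by omega) (by omega)]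
  generalize √(qInt q (i + 1) * qInt q (N - i)) = R
  field_simp
  have w := w_ne h0 h1
  simp only [qInt_eq h0, zpow_add₀ hQ, zpow_sub₀ hQ, mul_sub, mul_add, zpow_one, mul_one,
    zpow_ofNat, mul_comm (2 : ℤ) _, zpow_mul]
  have a1 := zpow_ne_zero i hQ
  have a2 := zpow_ne_zero r hQ
  have a3 := zpow_ne_zero N hQ
  generalize √q ^ i = x at *
  generalize √q ^ r = y at *
  generalize √q ^ N = z at *
  generalize √q = Q at *
  field_simp
  ring

theorem bsa_mid (h0 : 0 < q) (h1 : q ≠ 1) (h : Lawful N i r) (h' : r + 1 ≤ N) :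
    aUp q N i r * bUp q N i (r + 1) + aDn q N i r * bDn q N i (r + 1)
      = q * (bUp q (N - 1) (i - 1) r * aUp q (N - 1) (i - 1) r
        + bDn q (N + 1) i (r + 1) * aDn q (N + 1) i (r + 1)) := by
  obtain ⟨⟨hi, hiN⟩, hr, hrN⟩ := h
  have hQ := (Real.sqrt_pos.2 h0).ne'
  have n0 := (@qInt_pos q h0 h1 N (by omega)).ne'
  have n1 := (@qInt_pos q h0 h1 (N + 1) (by omega)).ne'
  have n2 := (@qInt_pos q h0 h1 (N + 1 + 1) (by omega)).ne'
  simp only [aUp, aDn, bUp, bDn, neg_mul, mul_neg]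
  simp only [cf_comm q _ (i + 1), cf_comm q _ (N - i), cf_comm q _ (i - 1 + 1),
    cf_comm q _ (N + 1 - i)]
  rw [mul_add]
  simp only [mul_neg, ← mul_assoc q, q_cf h0]
  rw [cf_common h0 h1 (r + 1) (N - r) (N + 1) (by omega) (by omega) (by omega) (by omega),
    cf_common h0 h1 (r + 1) (N - r) (N) (by omega) (by omega) (by omega) (by omega),
    cf_common h0 h1 (r + 1) (N - r) (N) (by omega) (by omega) (by omega) (by omega),
    cf_common h0 h1 (r + 1) (N - r) (N + 1) (by omega) (by omega) (by omega) (by omega)]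
  generalize √(qInt q (r + 1) * qInt q (N - r)) = R
  field_simp
  have w := w_ne h0 h1
  simp only [qInt_eq h0, zpow_add₀ hQ, zpow_sub₀ hQ, mul_sub, mul_add, zpow_one, mul_one,
    zpow_ofNat, mul_comm (2 : ℤ) _, zpow_mul]
  have a1 := zpow_ne_zero i hQ
  have a2 := zpow_ne_zero r hQ
  have a3 := zpow_ne_zero N hQ
  generalize √q ^ i = x at *
  generalize √q ^ r = y at *
  generalize √q ^ N = z at *
  generalize √q = Q at *
  field_simp
  ring

theorem bbs_mid (h0 : 0 < q) (h1 : q ≠ 1) (h : Lawful N i r) :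
    bUp q (N - 1) (i - 1) r * bUp q (N - 1) (i - 1) r
      + bDn q (N + 1) i (r + 1) * bDn q (N + 1) i (r + 1)
      = bUp q N i r * bUp q N i r + bDn q N i r * bDn q N i r := by
  obtain ⟨⟨hi, hiN⟩, hr, hrN⟩ := h
  have hQ := (Real.sqrt_pos.2 h0).ne'
  have n1 := (@qInt_pos q h0 h1 (N + 1) (by omega)).ne'
  have n2 := (@qInt_pos q h0 h1 (N + 1 + 1) (by omega)).ne'
  simp only [aUp, aDn, bUp, bDn, neg_mul_neg]
  rw [cf_sq h0 h1 (N) (by omega) (by omega),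
    cf_sq h0 h1 (N + 1) (by omega) (by omega),
    cf_sq h0 h1 (N + 1) (by omega) (by omega),
    cf_sq h0 h1 (N) (by omega) (by omega)]
  rcases (show 0 ≤ N by omega).eq_or_lt with hN | hN
  · obtain rfl : i = 0 := by omega
    obtain rfl : r = 0 := by omega
    subst hN
    have w := w_ne h0 h1
    simp [qInt_zero] at *
  have n0 := (@qInt_pos q h0 h1 N hN).ne'
  field_simp
  have w := w_ne h0 h1
  simp only [qInt_eq h0, zpow_add₀ hQ, zpow_sub₀ hQ, mul_sub, mul_add, zpow_one, mul_one,
    zpow_ofNat, mul_comm (2 : ℤ) _, zpow_mul]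
  have a1 := zpow_ne_zero i hQ
  have a2 := zpow_ne_zero r hQ
  have a3 := zpow_ne_zero N hQ
  generalize √q ^ i = x at *
  generalize √q ^ r = y at *
  generalize √q ^ N = z at *
  generalize √q = Q at *
  field_simp
  ring

theorem asa_mid (h0 : 0 < q) (h1 : q ≠ 1) (h : Lawful N i r) :
    aUp q N i r * aUp q N i r + aDn q N i r * aDn q N i r
      + q ^ 2 * (bUp q N i r * bUp q N i r + bDn q N i r * bDn q N i r) = 1 := by
  obtain ⟨⟨hi, hiN⟩, hr, hrN⟩ := h
  have hQ := (Real.sqrt_pos.2 h0).ne'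
  have n1 := (@qInt_pos q h0 h1 (N + 1) (by omega)).ne'
  have n2 := (@qInt_pos q h0 h1 (N + 1 + 1) (by omega)).ne'
  simp only [aUp, aDn, bUp, bDn, neg_mul_neg, mul_add, pow_two, mul_mul_mul_comm q q, q_cf h0]
  rw [cf_sq h0 h1 (N + 1) (by omega) (by omega),
    cf_sq h0 h1 (N) (by omega) (by omega),
    cf_sq h0 h1 (N + 1) (by omega) (by omega),
    cf_sq h0 h1 (N) (by omega) (by omega)]
  rcases (show 0 ≤ N by omega).eq_or_lt with hN | hN
  · obtain rfl : i = 0 := by omega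
    obtain rfl : r = 0 := by omega
    subst hN
    have w := w_ne h0 h1
    simp [qInt_zero] at *
    field_simp
    simp only [qInt_eq h0]
    generalize √q = Q at *
    field_simp
    ring
  have n0 := (@qInt_pos q h0 h1 N hN).ne'
  field_simp
  have w := w_ne h0 h1
  simp only [qInt_eq h0, zpow_add₀ hQ, zpow_sub₀ hQ, mul_sub, mul_add, zpow_one, mul_one,
    zpow_ofNat, mul_comm (2 : ℤ) _, zpow_mul]
  have a1 := zpow_ne_zero i hQ
  have a2 := zpow_ne_zero r hQ
  have a3 := zpow_ne_zero N hQ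
  generalize √q ^ i = x at *
  generalize √q ^ r = y at *
  generalize √q ^ N = z at *
  generalize √q = Q at *
  field_simp
  ring

theorem aas_mid (h0 : 0 < q) (h1 : q ≠ 1) (h : Lawful N i r) :
    aUp q (N - 1) (i - 1) (r - 1) * aUp q (N - 1) (i - 1) (r - 1)
      + aDn q (N + 1) i r * aDn q (N + 1) i r
      + (bUp q (N - 1) (i - 1) r * bUp q (N - 1) (i - 1) r
      + bDn q (N + 1) i (r + 1) * bDn q (N + 1) i (r + 1)) = 1 := by
  obtain ⟨⟨hi, hiN⟩, hr, hrN⟩ := h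
  have hQ := (Real.sqrt_pos.2 h0).ne'
  have n1 := (@qInt_pos q h0 h1 (N + 1) (by omega)).ne'
  have n2 := (@qInt_pos q h0 h1 (N + 1 + 1) (by omega)).ne'
  simp only [aUp, aDn, bUp, bDn, neg_mul_neg]
  rw [cf_sq h0 h1 (N) (by omega) (by omega),
    cf_sq h0 h1 (N + 1) (by omega) (by omega),
    cf_sq h0 h1 (N) (by omega) (by omega),
    cf_sq h0 h1 (N + 1) (by omega) (by omega)]
  rcases (show 0 ≤ N by omega).eq_or_lt with hN | hN
  · obtain rfl : i = 0 := by omega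
    obtain rfl : r = 0 := by omega
    subst hN
    have w := w_ne h0 h1
    simp [qInt_zero] at *
    field_simp
    simp only [qInt_eq h0]
    generalize √q = Q at *
    field_simp
    ring
  have n0 := (@qInt_pos q h0 h1 N hN).ne'
  field_simp
  have w := w_ne h0 h1
  simp only [qInt_eq h0, zpow_add₀ hQ, zpow_sub₀ hQ, mul_sub, mul_add, zpow_one, mul_one,
    zpow_ofNat, mul_comm (2 : ℤ) _, zpow_mul]
  have a1 := zpow_ne_zero i hQ
  have a2 := zpow_ne_zero r hQ
  have a3 := zpow_ne_zero N hQ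
  generalize √q ^ i = x at *
  generalize √q ^ r = y at *
  generalize √q ^ N = z at *
  generalize √q = Q at *
  field_simp
  ring

end coeff

theorem ket_smul_congr {N i r : ℤ} {c c' : ℝ} (h : Lawful N i r → c = c') :
    (c : ℂ) • ket N i r = (c' : ℂ) • ket N i r := by
  by_cases hl : Lawful N i r
  · rw [h hl]
  · have : ket N i r = 0 := dif_neg hl
    rw [this, smul_zero, smul_zero]

theorem pol_ext {M : Type} [AddCommGroup M] [Module ℂ M] {f g : Pol →ₗ[ℂ] M}
    (h : ∀ N i r, Lawful N i r →
      f (((1 : ℝ) : ℂ) • ket N i r) = g (((1 : ℝ) : ℂ) • ket N i r)) : f = g := by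
  refine Finsupp.lhom_ext' fun p => LinearMap.ext_ring ?_
  have := h p.N p.i p.r ⟨p.hi, p.hr⟩
  rw [Complex.ofReal_one, one_smul, ← ket_of] at this
  exact this

theorem int_norm (x : ℤ) : x + 1 + 1 = x + 2 ∧ x + 1 - 1 = x ∧ x - 1 + 1 = x ∧
    x - 1 - 1 = x - 2 := by omega

/-! The operators of left multiplication satisfy the defining relations. -/

section relations
variable {q : ℝ} {N i r : ℤ}

theorem aDn_side (c : ℝ) (h : Lawful N i r) : c * aDn q N i r = 0 ∨ Lawful (N - 1) i r := by
  by_cases h' : Lawful (N - 1) i r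
  · exact Or.inr h'
  left
  rcases (show N - i = 0 ∨ N - r = 0 by unfold Lawful at *; omega) with e | e <;>
    simp [aDn, cf, e, qInt_zero]

theorem bDn_side (c : ℝ) (h : Lawful N i r) : c * bDn q N i r = 0 ∨ Lawful (N - 1) i (r - 1) := by
  by_cases h' : Lawful (N - 1) i (r - 1)
  · exact Or.inr h'
  left
  rcases (show N - i = 0 ∨ r = 0 by unfold Lawful at *; omega) with e | e <;>
    simp [bDn, cf, e, qInt_zero]

theorem aUp_side (c : ℝ) (h : Lawful N i r) :
    c * aUp q (N - 1) (i - 1) (r - 1) = 0 ∨ Lawful (N - 1) (i - 1) (r - 1) := by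
  by_cases h' : Lawful (N - 1) (i - 1) (r - 1)
  · exact Or.inr h'
  left
  rcases (show i = 0 ∨ r = 0 by unfold Lawful at *; omega) with e | e <;>
    simp [aUp, cf, e, qInt_zero]

theorem bUp_side (c : ℝ) (h : Lawful N i r) :
    c * bUp q (N - 1) (i - 1) r = 0 ∨ Lawful (N - 1) (i - 1) r := by
  by_cases h' : Lawful (N - 1) (i - 1) r
  · exact Or.inr h'
  left
  rcases (show i = 0 ∨ N - 1 - r + 1 = 0 by unfold Lawful at *; omega) with e | e <;>
    simp [bUp, cf, e, qInt_zero]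

theorem up_side {N' i' r' : ℤ} (c : ℝ) (h : Lawful N i r)
    (e : N' = N + 1 ∧ (i' = i ∨ i' = i + 1) ∧ (r' = r ∨ r' = r + 1)) :
    c = 0 ∨ Lawful N' i' r' := by
  right; unfold Lawful at *; omega

theorem rel_ba (h0 : 0 < q) (h1 : q ≠ 1) : mulB q ∘ₗ mulA q = (q : ℂ) • (mulA q ∘ₗ mulB q) := by
  refine pol_ext fun N i r h => ?_
  simp only [LinearMap.comp_apply, LinearMap.smul_apply]
  rw [mulA_ket 1 (Or.inr h), mulB_ket 1 (Or.inr h), map_add, map_add,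
    mulB_ket _ (up_side _ h (by omega)), mulB_ket _ (aDn_side _ h),
    mulA_ket _ (up_side _ h (by omega)), mulA_ket _ (bDn_side _ h)]
  simp only [int_norm, one_mul]
  have H1 := ket_smul_congr (fun _ : Lawful (N + 2) (i + 2) (r + 1) => ba_top h0 h1 h)
  have H2 := ket_smul_congr (fun h' : Lawful N (i + 1) r => ba_mid h0 h1 h h'.1.2)
  have H3 := ket_smul_congr (fun _ : Lawful (N - 2) i (r - 1) => ba_bot h0 h1 h)
  push_cast at *
  linear_combination (norm := module) H1 + H2 + H3

theorem rel_bsa (h0 : 0 < q) (h1 : q ≠ 1) : mulB' q ∘ₗ mulA q = (q : ℂ) • (mulA q ∘ₗ mulB' q) := by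
  refine pol_ext fun N i r h => ?_
  simp only [LinearMap.comp_apply, LinearMap.smul_apply]
  rw [mulA_ket 1 (Or.inr h), mulB'_ket 1 (Or.inr h), map_add, map_add,
    mulB'_ket _ (up_side _ h (by omega)), mulB'_ket _ (aDn_side _ h),
    mulA_ket _ (bUp_side _ h), mulA_ket _ (up_side _ h (by omega))]
  simp only [int_norm, one_mul]
  have H1 := ket_smul_congr (fun _ : Lawful (N + 2) (i + 1) (r + 2) => bsa_top h0 h1 h)
  have H2 := ket_smul_congr (fun h' : Lawful N i (r + 1) => bsa_mid h0 h1 h h'.2.2)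
  have H3 := ket_smul_congr (fun _ : Lawful (N - 2) (i - 1) r => bsa_bot h0 h1 h)
  push_cast at *
  linear_combination (norm := module) H1 + H2 + H3

theorem rel_bbs (h0 : 0 < q) (h1 : q ≠ 1) : mulB q ∘ₗ mulB' q = mulB' q ∘ₗ mulB q := by
  refine pol_ext fun N i r h => ?_
  simp only [LinearMap.comp_apply]
  rw [mulB_ket 1 (Or.inr h), mulB'_ket 1 (Or.inr h), map_add, map_add,
    mulB'_ket _ (up_side _ h (by omega)), mulB'_ket _ (bDn_side _ h),
    mulB_ket _ (bUp_side _ h), mulB_ket _ (up_side _ h (by omega))]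
  simp only [int_norm, one_mul]
  have H1 := ket_smul_congr (fun _ : Lawful (N + 2) (i + 1) (r + 1) => bbs_top h0 h1 h)
  have H2 := ket_smul_congr (fun h' : Lawful N i r => bbs_mid h0 h1 h)
  have H3 := ket_smul_congr (fun _ : Lawful (N - 2) (i - 1) (r - 1) => bbs_bot h0 h1 h)
  push_cast at *
  linear_combination (norm := module) H1 + H2 + H3

theorem rel_asa (h0 : 0 < q) (h1 : q ≠ 1) : mulA' q ∘ₗ mulA q + ((q : ℂ) ^ 2) • (mulB' q ∘ₗ mulB q) = LinearMap.id := by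
  refine pol_ext fun N i r h => ?_
  simp only [LinearMap.comp_apply, LinearMap.add_apply, LinearMap.smul_apply, LinearMap.id_apply]
  rw [mulA_ket 1 (Or.inr h), mulB_ket 1 (Or.inr h), map_add, map_add,
    mulA'_ket _ (up_side _ h (by omega)), mulA'_ket _ (aDn_side _ h),
    mulB'_ket _ (up_side _ h (by omega)), mulB'_ket _ (bDn_side _ h)]
  simp only [int_norm, one_mul]
  have H1 := ket_smul_congr (fun _ : Lawful (N + 2) (i + 1) (r + 1) => asa_top h0 h1 h)
  have H2 := ket_smul_congr (fun h' : Lawful N i r => asa_mid h0 h1 h)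
  have H3 := ket_smul_congr (fun _ : Lawful (N - 2) (i - 1) (r - 1) => asa_bot h0 h1 h)
  push_cast at *
  linear_combination (norm := module) H1 + H2 + H3

theorem rel_aas (h0 : 0 < q) (h1 : q ≠ 1) : mulA q ∘ₗ mulA' q + mulB q ∘ₗ mulB' q = LinearMap.id := by
  refine pol_ext fun N i r h => ?_
  simp only [LinearMap.comp_apply, LinearMap.add_apply, LinearMap.id_apply]
  rw [mulA'_ket 1 (Or.inr h), mulB'_ket 1 (Or.inr h), map_add, map_add,
    mulA_ket _ (aUp_side _ h), mulA_ket _ (up_side _ h (by omega)),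
    mulB_ket _ (bUp_side _ h), mulB_ket _ (up_side _ h (by omega))]
  simp only [int_norm, one_mul]
  have H1 := ket_smul_congr (fun _ : Lawful (N + 2) (i + 1) (r + 1) => aas_top h0 h1 h)
  have H2 := ket_smul_congr (fun h' : Lawful N i r => aas_mid h0 h1 h)
  have H3 := ket_smul_congr (fun _ : Lawful (N - 2) (i - 1) (r - 1) => aas_bot h0 h1 h)
  push_cast at *
  linear_combination (norm := module) H1 + H2 + H3

end relations

/-- The completion of `ℂ[SU_q(2)]` for the inner product of the Haar state, in which the vectors
`|l m n⟩` are an orthonormal basis. -/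
abbrev L2 : Type := lp (fun _ : Idx => ℂ) 2

/-- The inclusion of `⨁_l V_l ⊗ V_l` into its completion. -/
noncomputable def incl : Pol →ₗ[ℂ] L2 :=
  Finsupp.linearCombination ℂ fun p : Idx => lp.single 2 p (1 : ℂ)

theorem incl_dense : DenseRange incl := by
  intro f
  have h := lp.hasSum_single (E := fun _ : Idx => ℂ) (p := 2) (by simp) f
  refine mem_closure_of_tendsto h (Filter.Eventually.of_forall fun s => ?_)
  refine ⟨∑ i ∈ s, Finsupp.single i (f i), ?_⟩
  rw [map_sum]
  refine Finset.sum_congr rfl fun i _ => ?_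
  rw [incl, Finsupp.linearCombination_single, ← lp.single_smul, smul_eq_mul, mul_one]

theorem inner_single (p p' : Idx) (x y : ℂ) :
    ⟪incl (Finsupp.single p x), incl (Finsupp.single p' y)⟫_ℂ
      = if p = p' then y * (starRingEnd ℂ) x else 0 := by
  rw [incl, Finsupp.linearCombination_single, Finsupp.linearCombination_single, inner_smul_left,
    inner_smul_right, lp.inner_single_left]
  by_cases h : p = p'
  · subst h
    simp [mul_comm]
  · simp [lp.single_apply, h]

open Classical in
theorem inner_ket_left (p : Idx) (N i r : ℤ) :
    ⟪incl (ket N i r), incl (ket p.N p.i p.r)⟫_ℂ = if N = p.N ∧ i = p.i ∧ r = p.r then 1 else 0 := by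
  by_cases h : Lawful N i r
  · rw [ket_lawful h, ← ket_of, inner_single]
    simp [Idx.ext_iff]
  · have h' : ¬ (N = p.N ∧ i = p.i ∧ r = p.r) := by
      rintro ⟨rfl, rfl, rfl⟩
      exact h ⟨p.hi, p.hr⟩
    rw [if_neg h', show ket N i r = 0 from dif_neg h, map_zero, inner_zero_left]

open Classical in
theorem inner_ket_right (p : Idx) (N i r : ℤ) :
    ⟪incl (ket p.N p.i p.r), incl (ket N i r)⟫_ℂ = if N = p.N ∧ i = p.i ∧ r = p.r then 1 else 0 := by
  rw [← inner_conj_symm, inner_ket_left, apply_ite (starRingEnd ℂ), map_one, map_zero]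

theorem adj_of_ket {S T : Pol →ₗ[ℂ] Pol}
    (h : ∀ p p' : Idx, ⟪incl (S (((1 : ℝ) : ℂ) • ket p.N p.i p.r)), incl (ket p'.N p'.i p'.r)⟫_ℂ
      = ⟪incl (ket p.N p.i p.r), incl (T (((1 : ℝ) : ℂ) • ket p'.N p'.i p'.r))⟫_ℂ) (v w : Pol) :
    ⟪incl (S v), incl w⟫_ℂ = ⟪incl v, incl (T w)⟫_ℂ := by
  induction v using Finsupp.induction_linear with
  | zero => simp
  | add v v' hv hv' => simp only [map_add, inner_add_left, hv, hv']
  | single p x =>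
    induction w using Finsupp.induction_linear with
    | zero => simp
    | add v v' hv hv' => simp only [map_add, inner_add_right, hv, hv']
    | single p' y =>
      have hp : ∀ (p : Idx) (x : ℂ), Finsupp.single p x = x • ket p.N p.i p.r := fun p x => by
        rw [← ket_of, Finsupp.smul_single, smul_eq_mul, mul_one]
      have := h p p'
      rw [Complex.ofReal_one, one_smul, one_smul] at this
      simp only [hp, map_smul, inner_smul_left, inner_smul_right, this]

theorem mulA_adj (q : ℝ) (v w : Pol) : ⟪incl (mulA q v), incl w⟫_ℂ = ⟪incl v, incl (mulA' q w)⟫_ℂ := by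
  refine adj_of_ket (fun p p' => ?_) v w
  rw [mulA_ket 1 (Or.inr ⟨p.hi, p.hr⟩), mulA'_ket 1 (Or.inr ⟨p'.hi, p'.hr⟩)]
  simp only [map_add, map_smul, inner_add_left, inner_add_right, inner_smul_left,
    inner_smul_right, inner_ket_left, inner_ket_right, Complex.conj_ofReal, one_mul]
  obtain ⟨N, i, r, -, -⟩ := p
  obtain ⟨N', i', r', -, -⟩ := p'
  congr 1
  · by_cases e : N + 1 = N' ∧ i + 1 = i' ∧ r + 1 = r'
    · obtain ⟨rfl, rfl, rfl⟩ := e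
      simp
    · rw [if_neg e, if_neg (by dsimp only; omega), mul_zero, mul_zero]
  · by_cases e : N - 1 = N' ∧ i = i' ∧ r = r'
    · obtain ⟨rfl, rfl, rfl⟩ := e
      simp
    · rw [if_neg e, if_neg (by dsimp only; omega), mul_zero, mul_zero]

theorem mulB_adj (q : ℝ) (v w : Pol) : ⟪incl (mulB q v), incl w⟫_ℂ = ⟪incl v, incl (mulB' q w)⟫_ℂ := by
  refine adj_of_ket (fun p p' => ?_) v w
  rw [mulB_ket 1 (Or.inr ⟨p.hi, p.hr⟩), mulB'_ket 1 (Or.inr ⟨p'.hi, p'.hr⟩)]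
  simp only [map_add, map_smul, inner_add_left, inner_add_right, inner_smul_left,
    inner_smul_right, inner_ket_left, inner_ket_right, Complex.conj_ofReal, one_mul]
  obtain ⟨N, i, r, -, -⟩ := p
  obtain ⟨N', i', r', -, -⟩ := p'
  congr 1
  · by_cases e : N + 1 = N' ∧ i + 1 = i' ∧ r = r'
    · obtain ⟨rfl, rfl, rfl⟩ := e
      simp
    · rw [if_neg e, if_neg (by dsimp only; omega), mul_zero, mul_zero]
  · by_cases e : N - 1 = N' ∧ i = i' ∧ r - 1 = r'
    · obtain ⟨rfl, rfl, rfl⟩ := e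
      simp
    · rw [if_neg e, if_neg (by dsimp only; omega), mul_zero, mul_zero]

/-- The bounded extension of `mulA`. -/
noncomputable def opA (q : ℝ) : L2 →L[ℂ] L2 := (incl ∘ₗ mulA q).extendOfNorm incl

/-- The bounded extension of `mulB`. -/
noncomputable def opB (q : ℝ) : L2 →L[ℂ] L2 := (incl ∘ₗ mulB q).extendOfNorm incl

/-! Boundedness of the operators of left multiplication. -/

section bounded
variable {q : ℝ}

theorem norm_mulAB (h0 : 0 < q) (h1 : q ≠ 1) (v : Pol) :
    ‖incl (mulA q v)‖ ^ 2 + q ^ 2 * ‖incl (mulB q v)‖ ^ 2 = ‖incl v‖ ^ 2 := by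
  have h := congrArg (fun w => ⟪incl v, incl w⟫_ℂ) (LinearMap.congr_fun (rel_asa h0 h1) v)
  simp only [LinearMap.add_apply, LinearMap.comp_apply, LinearMap.smul_apply, LinearMap.id_apply,
    map_add, map_smul, inner_add_right, inner_smul_right, ← mulA_adj, ← mulB_adj,
    inner_self_eq_norm_sq_to_K] at h
  apply Complex.ofReal_injective
  push_cast
  simpa using h

theorem norm_mulAB' (h0 : 0 < q) (h1 : q ≠ 1) (v : Pol) :
    ‖incl (mulA' q v)‖ ^ 2 + ‖incl (mulB' q v)‖ ^ 2 = ‖incl v‖ ^ 2 := by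
  have h := congrArg (fun w => ⟪incl w, incl v⟫_ℂ) (LinearMap.congr_fun (rel_aas h0 h1) v)
  simp only [LinearMap.add_apply, LinearMap.comp_apply, LinearMap.id_apply,
    map_add, inner_add_left, mulA_adj, mulB_adj, inner_self_eq_norm_sq_to_K] at h
  apply Complex.ofReal_injective
  push_cast
  simpa using h

theorem mulA_bdd (h0 : 0 < q) (h1 : q ≠ 1) (v : Pol) : ‖incl (mulA q v)‖ ≤ 1 * ‖incl v‖ := by
  have := norm_mulAB h0 h1 v
  rw [one_mul]
  refine le_of_sq_le_sq ?_ (norm_nonneg _)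
  nlinarith [mul_nonneg (sq_nonneg q) (sq_nonneg ‖incl (mulB q v)‖)]

theorem mulB_bdd (h0 : 0 < q) (h1 : q ≠ 1) (v : Pol) : ‖incl (mulB q v)‖ ≤ q⁻¹ * ‖incl v‖ := by
  have := norm_mulAB h0 h1 v
  rw [inv_mul_eq_div, le_div_iff₀ h0]
  refine le_of_sq_le_sq ?_ (norm_nonneg _)
  nlinarith [sq_nonneg ‖incl (mulA q v)‖]

theorem mulA'_bdd (h0 : 0 < q) (h1 : q ≠ 1) (v : Pol) : ‖incl (mulA' q v)‖ ≤ 1 * ‖incl v‖ := by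
  have := norm_mulAB' h0 h1 v
  rw [one_mul]
  refine le_of_sq_le_sq ?_ (norm_nonneg _)
  nlinarith [sq_nonneg ‖incl (mulB' q v)‖]

theorem mulB'_bdd (h0 : 0 < q) (h1 : q ≠ 1) (v : Pol) : ‖incl (mulB' q v)‖ ≤ 1 * ‖incl v‖ := by
  have := norm_mulAB' h0 h1 v
  rw [one_mul]
  refine le_of_sq_le_sq ?_ (norm_nonneg _)
  nlinarith [sq_nonneg ‖incl (mulA' q v)‖]

theorem opA_incl (h0 : 0 < q) (h1 : q ≠ 1) (v : Pol) : opA q (incl v) = incl (mulA q v) :=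
  LinearMap.extendOfNorm_eq incl_dense ⟨1, mulA_bdd h0 h1⟩ v

theorem opB_incl (h0 : 0 < q) (h1 : q ≠ 1) (v : Pol) : opB q (incl v) = incl (mulB q v) :=
  LinearMap.extendOfNorm_eq incl_dense ⟨q⁻¹, mulB_bdd h0 h1⟩ v

end bounded

theorem clm_ext {S T : L2 →L[ℂ] L2} (h : ∀ v, S (incl v) = T (incl v)) : S = T :=
  ContinuousLinearMap.coeFn_injective (incl_dense.equalizer S.continuous T.continuous (funext h))

theorem star_incl {S : L2 →L[ℂ] L2} {s t : Pol →ₗ[ℂ] Pol} {C : ℝ}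
    (hS : ∀ v, S (incl v) = incl (s v)) (ht : ∀ v, ‖incl (t v)‖ ≤ C * ‖incl v‖)
    (h : ∀ v w, ⟪incl (s v), incl w⟫_ℂ = ⟪incl v, incl (t w)⟫_ℂ) (v : Pol) :
    star S (incl v) = incl (t v) := by
  have e := LinearMap.extendOfNorm_eq (f := incl ∘ₗ t) incl_dense ⟨C, ht⟩
  refine incl_dense.eq_of_inner_left (𝕜 := ℂ) ?_
  intro w
  rw [ContinuousLinearMap.star_eq_adjoint, ContinuousLinearMap.adjoint_inner_left, hS,
    ← inner_conj_symm, h, inner_conj_symm]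

section rep
variable {q : ℝ}

theorem opA_star_incl (h0 : 0 < q) (h1 : q ≠ 1) (v : Pol) : star (opA q) (incl v) = incl (mulA' q v) :=
  star_incl (opA_incl h0 h1) (mulA'_bdd h0 h1) (mulA_adj q) v

theorem opB_star_incl (h0 : 0 < q) (h1 : q ≠ 1) (v : Pol) : star (opB q) (incl v) = incl (mulB' q v) :=
  star_incl (opB_incl h0 h1) (mulB'_bdd h0 h1) (mulB_adj q) v

theorem op_ba (h0 : 0 < q) (h1 : q ≠ 1) : opB q * opA q = (q : ℂ) • (opA q * opB q) := clm_ext fun v => by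
  change opB q (opA q (incl v)) = (q : ℂ) • opA q (opB q (incl v))
  rw [opA_incl h0 h1, opB_incl h0 h1, opB_incl h0 h1, opA_incl h0 h1, ← map_smul]
  exact congrArg incl (LinearMap.congr_fun (rel_ba h0 h1) v)

theorem op_bsa (h0 : 0 < q) (h1 : q ≠ 1) : star (opB q) * opA q = (q : ℂ) • (opA q * star (opB q)) := clm_ext fun v => by
  change star (opB q) (opA q (incl v)) = (q : ℂ) • opA q (star (opB q) (incl v))
  rw [opA_incl h0 h1, opB_star_incl h0 h1, opB_star_incl h0 h1, opA_incl h0 h1, ← map_smul]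
  exact congrArg incl (LinearMap.congr_fun (rel_bsa h0 h1) v)

theorem op_bbs (h0 : 0 < q) (h1 : q ≠ 1) : opB q * star (opB q) = star (opB q) * opB q := clm_ext fun v => by
  change opB q (star (opB q) (incl v)) = star (opB q) (opB q (incl v))
  rw [opB_incl h0 h1, opB_star_incl h0 h1, opB_star_incl h0 h1, opB_incl h0 h1]
  exact congrArg incl (LinearMap.congr_fun (rel_bbs h0 h1) v)

theorem op_asa (h0 : 0 < q) (h1 : q ≠ 1) : star (opA q) * opA q + ((q : ℂ) ^ 2) • (star (opB q) * opB q) = 1 :=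
  clm_ext fun v => by
  change star (opA q) (opA q (incl v)) + ((q : ℂ) ^ 2) • star (opB q) (opB q (incl v)) = incl v
  rw [opA_incl h0 h1, opB_incl h0 h1, opA_star_incl h0 h1, opB_star_incl h0 h1, ← map_smul,
    ← map_add]
  exact congrArg incl (LinearMap.congr_fun (rel_asa h0 h1) v)

theorem op_aas (h0 : 0 < q) (h1 : q ≠ 1) : opA q * star (opA q) + opB q * star (opB q) = 1 := clm_ext fun v => by
  change opA q (star (opA q) (incl v)) + opB q (star (opB q) (incl v)) = incl v
  rw [opA_star_incl h0 h1, opB_star_incl h0 h1, opA_incl h0 h1, opB_incl h0 h1, ← map_add]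
  exact congrArg incl (LinearMap.congr_fun (rel_aas h0 h1) v)

end rep

/-- The operators of the generators: `a`, `b` act by left multiplication, `a*`, `b*` by adjoints. -/
noncomputable def opGen (q : ℝ) : Gen → (L2 →L[ℂ] L2)
  | .a => opA q
  | .b => opB q
  | .aStar => star (opA q)
  | .bStar => star (opB q)

theorem opGen_conj (q : ℝ) (g : Gen) : opGen q g.conj = star (opGen q g) := by
  cases g <;> simp [opGen, Gen.conj]

section regular
variable {q : ℝ} (h0 : 0 < q) (h1 : q ≠ 1)

theorem regular_rel (h0 : 0 < q) (h1 : q ≠ 1) ⦃x y : FreeAlgebra ℂ Gen⦄ (h : Rel q x y) :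
    FreeAlgebra.lift ℂ (opGen q) x = FreeAlgebra.lift ℂ (opGen q) y := by
  have c : star (q : ℂ) = q := Complex.conj_ofReal q
  cases h <;> simp only [map_mul, map_smul, map_add, map_one, FreeAlgebra.lift_ι_apply, opGen]
  · exact op_ba h0 h1
  · exact op_bsa h0 h1
  · simpa only [star_mul, star_smul, c] using congrArg star (op_ba h0 h1)
  · simpa only [star_mul, star_smul, star_star, c] using congrArg star (op_bsa h0 h1)
  · exact op_bbs h0 h1
  · exact op_asa h0 h1
  · exact op_aas h0 h1

/-- The left regular representation, as an algebra homomorphism. -/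
noncomputable def regularHom : Alg q →ₐ[ℂ] (L2 →L[ℂ] L2) :=
  RingQuot.liftAlgHom ℂ ⟨FreeAlgebra.lift ℂ (opGen q), regular_rel h0 h1⟩

theorem regularHom_gen (g : Gen) : regularHom h0 h1 (gen q g) = opGen q g := by
  rw [regularHom, gen, RingQuot.liftAlgHom_mkAlgHom_apply, FreeAlgebra.lift_ι_apply]

/-- The left regular (GNS) `*`-representation of `ℂ[SU_q(2)]`. -/
noncomputable def regular : Alg q →⋆ₐ[ℂ] (L2 →L[ℂ] L2) where
  __ := regularHom h0 h1
  map_star' x := by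
    change regularHom h0 h1 (star x) = star (regularHom h0 h1 x)
    induction x using alg_induction with
    | h1 => rw [alg_star_one, map_one, star_one]
    | hg g => rw [star_gen, regularHom_gen, regularHom_gen, opGen_conj]
    | hs c x h => rw [alg_star_smul, map_smul, map_smul, star_smul, h]; rfl
    | hm x y hx hy => rw [star_mul, map_mul, map_mul, star_mul, hx, hy]
    | ha x y hx hy => rw [star_add, map_add, map_add, star_add, hx, hy]
end regular

/-! ### The spinor Hilbert space and its representation -/

/-- The Hilbert space `𝐇 = L2 ⊗ Σ`, the completion of `ℂ[SU_q(2)] ⊗ Σ`, where `Σ = V_{1/2}` has the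
orthonormal basis `|½, ½⟩` (index `0`), `|½, -½⟩` (index `1`). -/
abbrev Hilb : Type := PiLp 2 (fun _ : Fin 2 => L2)

/-- The amplification `T ↦ T ⊗ 1` to the spinor space. -/
noncomputable def amplify : (L2 →L[ℂ] L2) →⋆ₐ[ℂ] (Hilb →L[ℂ] Hilb) where
  toFun T := (PiLp.continuousLinearEquiv 2 ℂ (fun _ : Fin 2 => L2)).symm.toContinuousLinearMap ∘L
    ContinuousLinearMap.pi fun s => T ∘L PiLp.proj 2 (fun _ : Fin 2 => L2) s
  map_one' := by ext; rfl
  map_mul' S T := by ext; rfl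
  map_zero' := by ext; rfl
  map_add' S T := by ext; rfl
  commutes' c := by ext; rfl
  map_star' T := by
    rw [ContinuousLinearMap.star_eq_adjoint, ContinuousLinearMap.star_eq_adjoint,
      ContinuousLinearMap.eq_adjoint_iff]
    intro x y
    simp only [PiLp.inner_apply]
    refine Finset.sum_congr rfl fun s _ => ?_
    exact ContinuousLinearMap.adjoint_inner_left T (y s) (x s)

theorem amplify_apply (T : L2 →L[ℂ] L2) (ψ : Hilb) (s : Fin 2) : amplify T ψ s = T (ψ s) := rfl

/-- The spinor representation `η` of `ℂ[SU_q(2)]` on `𝐇`: left multiplication on the first factor. -/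
noncomputable def spinorRep {q : ℝ} (h0 : 0 < q) (h1 : q ≠ 1) : Alg q →⋆ₐ[ℂ] (Hilb →L[ℂ] Hilb) :=
  amplify.comp (regular h0 h1)

/-- The algebraic spinor space `(⨁_l V_l ⊗ V_l) ⊗ Σ`. -/
abbrev PreHilb : Type := Pol ⊗[ℂ] (Fin 2 → ℂ)

/-- The inclusion of the algebraic spinor space into `𝐇`. -/
noncomputable def inclS : PreHilb →ₗ[ℂ] Hilb :=
  TensorProduct.lift (LinearMap.mk₂ ℂ
    (fun (f : Pol) (v : Fin 2 → ℂ) => (WithLp.toLp 2 fun s => v s • incl f : Hilb))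
    (fun f g v => by ext1 s; simp [smul_add])
    (fun c f v => by ext1 s; simpa using smul_comm (v s) c (incl f))
    (fun f v w => by ext1 s; simp [add_smul])
    (fun c f v => by ext1 s; simp [mul_smul]))

/-! ### The Dirac operator -/

/-- The action of `e` on the first tensor factor:
`e |l, m⟩ = ([l-m][l+m+1])^{1/2} |l, m+1⟩`. -/
noncomputable def actE (q : ℝ) : Pol →ₗ[ℂ] Pol :=
  Finsupp.linearCombination ℂ fun p : Idx =>
    (√(qInt q (p.N - p.i) * qInt q (p.i + 1)) : ℂ) • ket p.N (p.i + 1) p.r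

/-- The action of `f` on the first tensor factor:
`f |l, m⟩ = ([l-m+1][l+m])^{1/2} |l, m-1⟩`. -/
noncomputable def actF (q : ℝ) : Pol →ₗ[ℂ] Pol :=
  Finsupp.linearCombination ℂ fun p : Idx =>
    (√(qInt q (p.N - p.i + 1) * qInt q p.i) : ℂ) • ket p.N (p.i - 1) p.r

/-- The action of `k⁻¹` on the first tensor factor: `k⁻¹ |l, m⟩ = q^{-m} |l, m⟩`. -/
noncomputable def actKinv (q : ℝ) : Pol →ₗ[ℂ] Pol :=
  Finsupp.linearCombination ℂ fun p : Idx => ((√q ^ (p.N - 2 * p.i) : ℝ) : ℂ) • ket p.N p.i p.r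

/-- `Z₁ = k⁻¹ e`. -/
noncomputable def Zplus (q : ℝ) : Pol →ₗ[ℂ] Pol := actKinv q ∘ₗ actE q

/-- `Z₀ = [2]^{-1/2} (q⁻¹ f e - q e f)`. -/
noncomputable def Zzero (q : ℝ) : Pol →ₗ[ℂ] Pol :=
  (((√(qInt q 2))⁻¹ : ℝ) : ℂ) •
    (((q⁻¹ : ℝ) : ℂ) • (actF q ∘ₗ actE q) - (q : ℂ) • (actE q ∘ₗ actF q))

/-- `Z₋₁ = -k⁻¹ f`. -/
noncomputable def Zminus (q : ℝ) : Pol →ₗ[ℂ] Pol := -(actKinv q ∘ₗ actF q)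

/-- The matrix of `ψ₁` on `Σ`. -/
noncomputable def psiPlus (q : ℝ) : Matrix (Fin 2) (Fin 2) ℂ := !![0, (√q : ℂ); 0, 0]

/-- The matrix of `ψ₀` on `Σ`. -/
noncomputable def psiZero (q : ℝ) : Matrix (Fin 2) (Fin 2) ℂ :=
  (-((√(qInt q 2))⁻¹ : ℝ) : ℂ) • !![((q⁻¹ : ℝ) : ℂ), 0; 0, -(q : ℂ)]

/-- The matrix of `ψ₋₁` on `Σ`. -/
noncomputable def psiMinus (q : ℝ) : Matrix (Fin 2) (Fin 2) ℂ := !![0, 0; -(√(q⁻¹) : ℂ), 0]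

/-- The Dirac operator
`D = -q [2] Z₁ ⊗ ψ₋₁ + [2] Z₀ ⊗ ψ₀ - q⁻¹ [2] Z₋₁ ⊗ ψ₁` on the algebraic spinor space. -/
noncomputable def dirac (q : ℝ) : PreHilb →ₗ[ℂ] PreHilb :=
  ((-(q * qInt q 2) : ℝ) : ℂ) • TensorProduct.map (Zplus q) (Matrix.toLin' (psiMinus q))
    + (qInt q 2 : ℂ) • TensorProduct.map (Zzero q) (Matrix.toLin' (psiZero q))
    + ((-(q⁻¹ * qInt q 2) : ℝ) : ℂ) • TensorProduct.map (Zminus q) (Matrix.toLin' (psiPlus q))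

/-! ### Fredholm modules -/

section Fredholm
variable {H : Type*} [NormedAddCommGroup H] [InnerProductSpace ℂ H] [CompleteSpace H]

/-- `F = D (1 + D²)^{-1/2}` for an operator `D` with core `V`, densely included in `H` by `j`.
The operator `R` is `(1 + D²)^{-1/2}`: the positive square root of the inverse of `1 + D²`.
The last clause says that `R x` lies in the domain of the closure `D̄` of `D`
and that `F x = D̄ (R x)`. -/
def IsBoundedTransform {V : Type*} [AddCommMonoid V] [Module ℂ V] (j : V →ₗ[ℂ] H)
    (D : V →ₗ[ℂ] V) (F : H →L[ℂ] H) : Prop :=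
  ∃ R : H →L[ℂ] H, R.IsPositive ∧ (∀ v, R (R (j (v + D (D v)))) = j v) ∧
    ∀ x, (R x, F x) ∈ closure (Set.range fun v => (j v, j (D v)))

/-- Trace class (nuclear) operators: `T = ∑ₙ ⟨xₙ, ·⟩ yₙ` with `∑ₙ ‖xₙ‖ ‖yₙ‖ < ∞`. -/
def IsTraceClass (T : H →L[ℂ] H) : Prop :=
  ∃ x y : ℕ → H, Summable (fun n => ‖x n‖ * ‖y n‖) ∧
    ∀ v, HasSum (fun n => ⟪x n, v⟫_ℂ • y n) (T v)

/-- `(A, F, H)` is a `1`-summable Fredholm module, where the `*`-algebra `A` acts on `H` by the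
`*`-representation `η`. -/
structure IsOneSummableFredholmModule {A : Type*} [Ring A] [StarRing A] [Algebra ℂ A]
    (η : A →⋆ₐ[ℂ] (H →L[ℂ] H)) (F : H →L[ℂ] H) : Prop where
  isSelfAdjoint : IsSelfAdjoint F
  sq_sub_one : IsTraceClass (F * F - 1)
  commutator : ∀ x : A, IsTraceClass (F * η x - η x * F)

end Fredholm

end SUq2

/-!
The Dirac operator `D` acts on the first index and on the spin only. It preserves each span of
`|N, i, r⟩ ⊗ |½, ½⟩` and `|N, i + 1, r⟩ ⊗ |½, -½⟩` (with `N = 2 l`), and there it has the eigenvalues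
`[N]` and `-[N + 2]` (`dirac_eq_cal`). Let `P` (`proj`) be the spectral projection for the eigenvalues
`[N]`; its matrix entries are explicit. All functions of `D` are then operators
`φ(N) P + ψ(N) (1 - P)` on the algebraic spinor space (`cal`). They multiply like pairs of functions and
are symmetric, so that boundedness and positivity come from algebra: `φ² + √(1 - φ²)² = 1` makes the
operator of a function of modulus at most one a contraction, and a nonnegative function is a square.
This yields `R = (1 + D²)^{-1/2}` and `F = D R`. Uniqueness holds because `1 + D²` maps the algebraic
spinor space onto itself, positive square roots are unique, and the symmetric operator `D` is closable
(`isBoundedTransform_iff`).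

An operator `T` is trace class if `∑ ‖T e‖ < ∞` over an orthonormal basis. As the weight `l` has
multiplicity `2 (2 l + 1)²`, exponential decay of `‖T e‖` in `l` is enough (`isTraceClass_of_decay`). The
`q`-integers grow exponentially, so this applies to `F² - 1 = -(1 + D²)⁻¹` and to `F - (2 P - 1)`. It
remains to treat `[P, η(x)]`, and, by the Leibniz rule and adjoints, only for `x = a` and `x = b`. Each of
these is the sum of a part raising `l` and a part lowering `l`, and the commutator of such a part with
`P` has four matrix entries, each of which collapses to a single product of powers of `√q`, square roots
of `q`-integers and inverse `q`-integers (`projDiag_up`, `projDiag_down`, `off_plus_up` and its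
companions). With `τ = min(√q, 1/√q)` one has `√q ^ e ≤ τ ^ (-|e|)`, `√[n] ≤ C τ ^ (-n)` and
`1 / √[n] ≤ C τ ^ n` (`Growth`), and counting exponents bounds every entry by a constant times
`τ ^ (2 N)` (`exists_bound_commutator`).
-/

namespace SUq2

/-! ### Trace class operators -/

section TraceClass
variable {H : Type*} [NormedAddCommGroup H] [InnerProductSpace ℂ H]

/-- The sum defining a trace class operator may be indexed by any countably infinite type. -/
theorem IsTraceClass.of_equiv {ι : Type*} (e : ℕ ≃ ι) {T : H →L[ℂ] H} (x y : ι → H)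
    (hs : Summable fun k => ‖x k‖ * ‖y k‖)
    (hT : ∀ v, HasSum (fun k => ⟪x k, v⟫_ℂ • y k) (T v)) : IsTraceClass T :=
  ⟨x ∘ e, y ∘ e, (e.summable_iff (f := fun k => ‖x k‖ * ‖y k‖)).2 hs,
    fun v => (e.hasSum_iff (f := fun k => ⟪x k, v⟫_ℂ • y k)).2 (hT v)⟩

theorem IsTraceClass.add {S T : H →L[ℂ] H} (hS : IsTraceClass S) (hT : IsTraceClass T) :
    IsTraceClass (S + T) := by
  obtain ⟨x, y, hs, h⟩ := hS
  obtain ⟨x', y', hs', h'⟩ := hT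
  refine .of_equiv Equiv.natSumNatEquivNat.symm (Sum.elim x x') (Sum.elim y y') ?_ fun v => ?_
  · exact HasSum.summable (HasSum.sum (f := fun k => ‖Sum.elim x x' k‖ * ‖Sum.elim y y' k‖)
      (by simpa [Function.comp_def] using hs.hasSum) (by simpa [Function.comp_def] using hs'.hasSum))
  · exact HasSum.sum (f := fun k => ⟪Sum.elim x x' k, v⟫_ℂ • Sum.elim y y' k)
      (by simpa [Function.comp_def] using h v) (by simpa [Function.comp_def] using h' v)

theorem IsTraceClass.comp_left {T : H →L[ℂ] H} (hT : IsTraceClass T) (B : H →L[ℂ] H) :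
    IsTraceClass (B * T) := by
  obtain ⟨x, y, hs, h⟩ := hT
  refine ⟨x, fun n => B (y n), ?_, fun v => ?_⟩
  · refine Summable.of_nonneg_of_le (fun n => by positivity) (fun n => ?_) (hs.mul_left ‖B‖)
    calc ‖x n‖ * ‖B (y n)‖ ≤ ‖x n‖ * (‖B‖ * ‖y n‖) := by gcongr; exact B.le_opNorm _
      _ = _ := by ring
  · simpa using (h v).mapL B

theorem IsTraceClass.comp_right [CompleteSpace H] {T : H →L[ℂ] H} (hT : IsTraceClass T)
    (B : H →L[ℂ] H) : IsTraceClass (T * B) := by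
  obtain ⟨x, y, hs, h⟩ := hT
  refine ⟨fun n => star B (x n), y, ?_, fun v => ?_⟩
  · refine Summable.of_nonneg_of_le (fun n => by positivity) (fun n => ?_) (hs.mul_left ‖star B‖)
    calc ‖star B (x n)‖ * ‖y n‖ ≤ (‖star B‖ * ‖x n‖) * ‖y n‖ := by
          gcongr; exact (star B).le_opNorm _
      _ = _ := by ring
  · simpa [ContinuousLinearMap.star_eq_adjoint, ContinuousLinearMap.adjoint_inner_left]
      using h (B v)

theorem IsTraceClass.smul {T : H →L[ℂ] H} (hT : IsTraceClass T) (c : ℂ) :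
    IsTraceClass (c • T) := by
  simpa using hT.comp_left (c • (1 : H →L[ℂ] H))

theorem IsTraceClass.neg {T : H →L[ℂ] H} (hT : IsTraceClass T) : IsTraceClass (-T) := by
  simpa using hT.smul (-1)

theorem IsTraceClass.sub {S T : H →L[ℂ] H} (hS : IsTraceClass S) (hT : IsTraceClass T) :
    IsTraceClass (S - T) := by
  simpa [sub_eq_add_neg] using hS.add hT.neg

theorem IsTraceClass.star [CompleteSpace H] {T : H →L[ℂ] H} (hT : IsTraceClass T) :
    IsTraceClass (star T) := by
  obtain ⟨x, y, hs, h⟩ := hT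
  refine ⟨y, x, by simpa only [mul_comm] using hs, fun v => ?_⟩
  have hsum : Summable fun n => ⟪y n, v⟫_ℂ • x n := by
    refine Summable.of_norm_bounded (g := fun n => ‖v‖ * (‖x n‖ * ‖y n‖)) (hs.mul_left _)
      fun n => ?_
    calc ‖⟪y n, v⟫_ℂ • x n‖ ≤ (‖y n‖ * ‖v‖) * ‖x n‖ := by
          rw [norm_smul]; gcongr; exact norm_inner_le_norm _ _
      _ = _ := by ring
  have key : ∑' n, ⟪y n, v⟫_ℂ • x n = Star.star T v := by
    refine ext_inner_left ℂ fun w => ?_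
    rw [ContinuousLinearMap.star_eq_adjoint, ContinuousLinearMap.adjoint_inner_right]
    have h1 : HasSum (fun n => ⟪w, ⟪y n, v⟫_ℂ • x n⟫_ℂ) ⟪w, ∑' n, ⟪y n, v⟫_ℂ • x n⟫_ℂ :=
      hsum.hasSum.mapL (innerSL ℂ w)
    have h2 : HasSum (fun n => ⟪v, ⟪x n, w⟫_ℂ • y n⟫_ℂ) ⟪v, T w⟫_ℂ := (h w).mapL (innerSL ℂ v)
    have h3 := Complex.hasSum_conj'.2 h2
    rw [inner_conj_symm] at h3
    refine h1.unique (h3.congr_fun fun n => ?_)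
    rw [inner_smul_right, inner_smul_right, map_mul, inner_conj_symm, inner_conj_symm, mul_comm]
  rw [← key]
  exact hsum.hasSum

/-- An operator that is absolutely summable on a Hilbert basis is trace class. -/
theorem IsTraceClass.of_hilbertBasis {ι : Type*} (e : ℕ ≃ ι) (b : HilbertBasis ι ℂ H)
    (T : H →L[ℂ] H) (hs : Summable fun k => ‖T (b k)‖) : IsTraceClass T := by
  refine .of_equiv e b (fun k => T (b k)) (by simpa [b.orthonormal.1] using hs) fun v => ?_
  simpa [b.repr_apply_apply] using (b.hasSum_repr v).mapL T

end TraceClass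

/-! ### Characterisation of the bounded transform -/

section BoundedTransform
variable {H : Type*} [NormedAddCommGroup H] [InnerProductSpace ℂ H]
variable {V : Type*} [AddCommGroup V] [Module ℂ V]

/-- Bounded operators which agree on a densely included space are equal. -/
theorem eq_of_denseRange {j : V →ₗ[ℂ] H} (hj : DenseRange j) {S T : H →L[ℂ] H}
    (h : ∀ v, S (j v) = T (j v)) : S = T :=
  ContinuousLinearMap.coeFn_injective (hj.equalizer S.continuous T.continuous (funext h))

/-- A symmetric operator is closable. -/
theorem eq_zero_of_mem_closure_graph {j : V →ₗ[ℂ] H} (hj : DenseRange j) {D : V →ₗ[ℂ] V}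
    (hD : ∀ v w, ⟪j (D v), j w⟫_ℂ = ⟪j v, j (D w)⟫_ℂ) {y : H}
    (hy : ((0 : H), y) ∈ closure (Set.range fun v => (j v, j (D v)))) : y = 0 := by
  have hclosed : ∀ w, IsClosed {z : H × H | ⟪z.2, j w⟫_ℂ = ⟪z.1, j (D w)⟫_ℂ} := fun w =>
    isClosed_eq (by fun_prop) (by fun_prop)
  refine hj.eq_of_inner_left (𝕜 := ℂ) fun w => ?_
  have := closure_minimal (t := {z : H × H | ⟪z.2, j w⟫_ℂ = ⟪z.1, j (D w)⟫_ℂ})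
    (by rintro _ ⟨v, rfl⟩; exact hD v w) (hclosed w) hy
  simpa using this

/-- If `1 + D²` is onto the core and `R`, `F` behave on the core as `(1 + D²)^{-1/2}` and `D R`, then
`F` is the one and only bounded transform of the symmetric operator `D`. -/
theorem isBoundedTransform_iff [CompleteSpace H] {j : V →ₗ[ℂ] H} (hj : DenseRange j) {D : V →ₗ[ℂ] V}
    (hD : ∀ v w, ⟪j (D v), j w⟫_ℂ = ⟪j v, j (D w)⟫_ℂ) {R F : H →L[ℂ] H} (hpos : R.IsPositive)
    (hR : ∀ v, R (R (j (v + D (D v)))) = j v) (hsurj : ∀ w, ∃ v, v + D (D v) = w)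
    (hF : ∀ v, ∃ w, R (j v) = j w ∧ F (j v) = j (D w)) (F' : H →L[ℂ] H) :
    IsBoundedTransform j D F' ↔ F' = F := by
  have hgraph : ∀ x, (R x, F x) ∈ closure (Set.range fun v => (j v, j (D v))) := fun x => by
    refine hj.induction_on (p := fun x => (R x, F x) ∈ closure (Set.range fun v => (j v, j (D v))))
      x (isClosed_closure.preimage (by fun_prop)) fun v => ?_
    obtain ⟨w, h1, h2⟩ := hF v
    exact subset_closure ⟨w, by simp [h1, h2]⟩
  constructor
  · rintro ⟨R', hpos', hR', hgraph'⟩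
    have hsq : R' * R' = R * R := eq_of_denseRange hj fun w => by
      obtain ⟨v, rfl⟩ := hsurj w
      exact (hR' v).trans (hR v).symm
    have hRR : R' = R := by
      have p := (ContinuousLinearMap.nonneg_iff_isPositive _).2 hpos
      have p' := (ContinuousLinearMap.nonneg_iff_isPositive _).2 hpos'
      rw [← CFC.sqrt_mul_self R', hsq, CFC.sqrt_mul_self R]
    subst hRR
    let G : Submodule ℂ (H × H) := (LinearMap.range (j.prod (j ∘ₗ D))).topologicalClosure
    have hG : (G : Set (H × H)) = closure (Set.range fun v => (j v, j (D v))) := by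
      rw [Submodule.topologicalClosure_coe]; rfl
    ext x
    have h1 : (R' x, F' x) ∈ G := by rw [← SetLike.mem_coe, hG]; exact hgraph' x
    have h2 : (R' x, F x) ∈ G := by rw [← SetLike.mem_coe, hG]; exact hgraph x
    have h3 := G.sub_mem h1 h2
    rw [← SetLike.mem_coe, hG, Prod.mk_sub_mk, sub_self] at h3
    exact sub_eq_zero.1 (eq_zero_of_mem_closure_graph hj hD h3)
  · rintro rfl
    exact ⟨R, hpos, hR, hgraph⟩

end BoundedTransform

/-! ### The basis of the spinor space -/

/-- The group structure of the tensor product, recorded for `PreHilb` so that unification finds it. -/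
noncomputable instance : AddCommGroup PreHilb := TensorProduct.addCommGroup

/-- The vector `|l m n⟩ ⊗ |½, ±½⟩`, where `N = 2 l`, `i = l + m`, `r = l + n`, and the sign is `+` for
`s = 0` and `-` for `s = 1` (zero if the indices are out of range). -/
noncomputable def skt (N i r : ℤ) (s : Fin 2) : PreHilb := ket N i r ⊗ₜ[ℂ] (Pi.single s 1)

theorem skt_of_not {N i r : ℤ} (h : ¬ Lawful N i r) (s : Fin 2) : skt N i r s = 0 := by
  rw [skt, show ket N i r = 0 from dif_neg h, TensorProduct.zero_tmul]

/-- The vectors `|l m n⟩ ⊗ |½, ±½⟩` as a basis of the algebraic spinor space. -/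
noncomputable def sbasis : Module.Basis (Idx × Fin 2) ℂ PreHilb :=
  (Finsupp.basisSingleOne (R := ℂ) (ι := Idx)).tensorProduct (Pi.basisFun ℂ (Fin 2))

theorem sbasis_apply (p : Idx × Fin 2) : sbasis p = skt p.1.N p.1.i p.1.r p.2 := by
  obtain ⟨p, s⟩ := p
  rw [sbasis, Module.Basis.tensorProduct_apply, skt, ← ket_of]
  simp

theorem sbasis_lawful {N i r : ℤ} (h : Lawful N i r) (s : Fin 2) :
    skt N i r s = sbasis (⟨N, i, r, h.1, h.2⟩, s) := by
  rw [sbasis_apply]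

theorem prehilb_ext {f g : PreHilb →ₗ[ℂ] PreHilb}
    (h : ∀ N i r s, Lawful N i r → f (skt N i r s) = g (skt N i r s)) : f = g :=
  sbasis.ext fun p => by
    rw [sbasis_apply]
    exact h _ _ _ _ ⟨p.1.hi, p.1.hr⟩

theorem inclS_sbasis (p : Idx × Fin 2) :
    inclS (sbasis p) = WithLp.toLp 2 (Pi.single p.2 (lp.single 2 p.1 (1 : ℂ))) := by
  rw [sbasis_apply, skt, ← ket_of]
  change WithLp.toLp 2 (fun s => (Pi.single p.2 1 : Fin 2 → ℂ) s • incl (Finsupp.single p.1 1)) = _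
  congr 1
  ext1 s
  rw [incl, Finsupp.linearCombination_single, one_smul]
  by_cases h : s = p.2
  · subst h; simp
  · simp [h]

theorem inclS_orthonormal : Orthonormal ℂ fun p => inclS (sbasis p) := by
  rw [orthonormal_iff_ite]
  rintro ⟨p, s⟩ ⟨p', s'⟩
  simp only [inclS_sbasis, PiLp.inner_apply, Fin.sum_univ_two]
  have h : ∀ t : Fin 2, ⟪(Pi.single s (lp.single 2 p (1 : ℂ)) : Fin 2 → L2) t,
      (Pi.single s' (lp.single 2 p' (1 : ℂ)) : Fin 2 → L2) t⟫_ℂ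
      = if t = s ∧ t = s' ∧ p = p' then 1 else 0 := fun t => by
    by_cases h1 : t = s
    · by_cases h2 : t = s'
      · subst h1; subst h2
        simp only [Pi.single_eq_same]
        rw [lp.inner_single_left]
        by_cases h : p = p'
        · subst h; simp
        · simp [lp.single_apply, h]
      · simp [h2]
    · simp [h1]
  simp only [h, Prod.mk.injEq]
  fin_cases s <;> fin_cases s' <;> simp

theorem inclS_dense : DenseRange inclS := by
  have h : Submodule.topologicalClosure (LinearMap.range inclS) = ⊤ := by
    rw [Submodule.topologicalClosure_eq_top_iff, Submodule.eq_bot_iff]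
    intro x hx
    rw [Submodule.mem_orthogonal] at hx
    ext s p
    have := hx _ ⟨sbasis (p, s), rfl⟩
    rw [inclS_sbasis, PiLp.inner_apply, Finset.sum_eq_single s] at this
    · simpa [lp.inner_single_left] using this
    · intro t _ ht
      simp [ht]
    · simp
  rw [DenseRange, ← LinearMap.coe_range, Submodule.dense_iff_topologicalClosure_eq_top, h]

/-- The orthonormal basis `|l m n⟩ ⊗ |½, ±½⟩` of the spinor Hilbert space. -/
noncomputable def hbasis : HilbertBasis (Idx × Fin 2) ℂ Hilb :=
  HilbertBasis.mk inclS_orthonormal (by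
    have h : Set.range (fun p => inclS (sbasis p)) = inclS '' Set.range sbasis := by
      rw [← Set.range_comp]; rfl
    rw [h, Submodule.span_image, sbasis.span_eq, Submodule.map_top]
    exact (Submodule.dense_iff_topologicalClosure_eq_top.1
      (by rw [LinearMap.coe_range]; exact inclS_dense)).ge)

theorem hbasis_apply (p : Idx × Fin 2) : hbasis p = inclS (sbasis p) :=
  congrFun (HilbertBasis.coe_mk inclS_orthonormal _) p

theorem norm_inclS_sbasis (p : Idx × Fin 2) : ‖inclS (sbasis p)‖ = 1 := inclS_orthonormal.1 p

theorem sbasis_induction {p : PreHilb → Prop} (zero : p 0) (add : ∀ v w, p v → p w → p (v + w))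
    (smul : ∀ (c : ℂ) v, p v → p (c • v)) (basis : ∀ k, p (sbasis k)) (v : PreHilb) : p v := by
  have h : v ∈ Submodule.span ℂ (Set.range sbasis) := sbasis.mem_span v
  induction h using Submodule.span_induction with
  | mem x hx => obtain ⟨k, rfl⟩ := hx; exact basis k
  | zero => exact zero
  | add v w _ _ hv hw => exact add v w hv hw
  | smul c v _ hv => exact smul c v hv

/-- A linear map is symmetric if its matrix in the orthonormal basis is hermitian. -/
theorem symm_of_skt {S : PreHilb →ₗ[ℂ] PreHilb}
    (h : ∀ N i r s N' i' r' s', Lawful N i r → Lawful N' i' r' →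
      ⟪inclS (S (skt N i r s)), inclS (skt N' i' r' s')⟫_ℂ
        = ⟪inclS (skt N i r s), inclS (S (skt N' i' r' s'))⟫_ℂ) (v w : PreHilb) :
    ⟪inclS (S v), inclS w⟫_ℂ = ⟪inclS v, inclS (S w)⟫_ℂ := by
  induction v using sbasis_induction with
  | zero => simp
  | add v v' hv hv' => simp only [map_add, inner_add_left, hv, hv']
  | smul c v hv => simp only [map_smul, inner_smul_left, hv]
  | basis p =>
    induction w using sbasis_induction with
    | zero => simp
    | add v v' hv hv' => simp only [map_add, inner_add_right, hv, hv']
    | smul c v hv => simp only [map_smul, inner_smul_right, hv]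
    | basis p' =>
      rw [sbasis_apply, sbasis_apply]
      exact h _ _ _ _ _ _ _ _ ⟨p.1.hi, p.1.hr⟩ ⟨p'.1.hi, p'.1.hr⟩

open Classical in
theorem inner_skt_left {N' i' r' : ℤ} (h' : Lawful N' i' r') (N i r : ℤ) (s s' : Fin 2) :
    ⟪inclS (skt N i r s), inclS (skt N' i' r' s')⟫_ℂ
      = if N = N' ∧ i = i' ∧ r = r' ∧ s = s' then 1 else 0 := by
  by_cases h : Lawful N i r
  · rw [sbasis_lawful h, sbasis_lawful h', orthonormal_iff_ite.1 inclS_orthonormal]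
    simp [and_assoc]
  · rw [if_neg, skt_of_not h, map_zero, inner_zero_left]
    rintro ⟨rfl, rfl, rfl, -⟩
    exact h h'

open Classical in
theorem inner_skt_right {N' i' r' : ℤ} (h' : Lawful N' i' r') (N i r : ℤ) (s s' : Fin 2) :
    ⟪inclS (skt N' i' r' s'), inclS (skt N i r s)⟫_ℂ
      = if N = N' ∧ i = i' ∧ r = r' ∧ s = s' then 1 else 0 := by
  rw [← inner_conj_symm, inner_skt_left h', apply_ite (starRingEnd ℂ), map_one, map_zero]

/-! ### The spectral projection of the Dirac operator -/

/-- The matrix entry of the spectral projection at `|N, i, r⟩ ⊗ |½, ½⟩`. -/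
noncomputable def projDiag (q : ℝ) (N i : ℤ) : ℝ := q ^ (N - i) * qInt q (i + 1) / qInt q (N + 1)

/-- The matrix entry of the spectral projection between `|N, i, r⟩ ⊗ |½, ½⟩` and
`|N, i + 1, r⟩ ⊗ |½, -½⟩`. -/
noncomputable def projOff (q : ℝ) (N i : ℤ) : ℝ :=
  √q ^ (N - 2 * i - 1) * (√(qInt q (N - i)) * √(qInt q (i + 1))) / qInt q (N + 1)

section projcoeff
variable {q : ℝ}

theorem q_zpow (h0 : 0 < q) (n : ℤ) : q ^ n = (√q ^ n) ^ 2 := by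
  rw [← zpow_natCast, ← zpow_mul, mul_comm, zpow_mul, zpow_natCast, Real.sq_sqrt h0.le]

theorem projOff_left {N i : ℤ} (h : i = -1) : projOff q N i = 0 := by
  simp [projOff, h, qInt_zero]

theorem projOff_right {N i : ℤ} (h : i = N) : projOff q N i = 0 := by
  simp [projOff, h, qInt_zero]

theorem one_sub_projDiag (h0 : 0 < q) (h1 : q ≠ 1) {N i : ℤ} (hN : 0 ≤ N) :
    1 - projDiag q N i = q ^ (-i - 1) * qInt q (N - i) / qInt q (N + 1) := by
  have hQ := (Real.sqrt_pos.2 h0).ne'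
  have n1 := (@qInt_pos q h0 h1 (N + 1) (by omega)).ne'
  have w := w_ne h0 h1
  rw [projDiag, eq_div_iff n1, sub_mul, div_mul_cancel₀ _ n1]
  simp only [qInt_eq h0, q_zpow h0, zpow_add₀ hQ, zpow_sub₀ hQ, zpow_neg, zpow_one]
  have a1 := zpow_ne_zero i hQ
  have a3 := zpow_ne_zero N hQ
  generalize √q ^ i = x at *
  generalize √q ^ N = z at *
  generalize √q = Q at *
  field_simp
  ring

theorem projOff_sq (h0 : 0 < q) (h1 : q ≠ 1) {N i : ℤ} (hi : -1 ≤ i) (hN : i ≤ N) (h : 0 ≤ N) :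
    projOff q N i * projOff q N i = projDiag q N i * (1 - projDiag q N i) := by
  have hQ := (Real.sqrt_pos.2 h0).ne'
  have n1 := (@qInt_pos q h0 h1 (N + 1) (by omega)).ne'
  rw [one_sub_projDiag h0 h1 h, projDiag, projOff]
  have s1 := Real.mul_self_sqrt (@qInt_nonneg q h0 h1 (i + 1) (by omega))
  have s2 := Real.mul_self_sqrt (@qInt_nonneg q h0 h1 (N - i) (by omega))
  rw [div_mul_div_comm, div_mul_div_comm]
  congr 1
  have e : √q ^ (N - 2 * i - 1) * √q ^ (N - 2 * i - 1) = q ^ (N - i) * q ^ (-i - 1) := by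
    rw [q_zpow h0, q_zpow h0, ← mul_pow, ← zpow_add₀ hQ (N - i), ← pow_two]
    congr 2; ring
  linear_combination (√(qInt q (N - i)) * √(qInt q (i + 1))) ^ 2 * e
    + q ^ (N - i) * q ^ (-i - 1) * (√(qInt q (N - i)) * √(qInt q (N - i)) * s1 + qInt q (i + 1) * s2)

end projcoeff

/-- The spectral projection of the Dirac operator for the eigenvalues `[2 l]`. It preserves the span
of `|N, i, r⟩ ⊗ |½, ½⟩` and `|N, i + 1, r⟩ ⊗ |½, -½⟩`. -/
noncomputable def proj (q : ℝ) : PreHilb →ₗ[ℂ] PreHilb :=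
  sbasis.constr ℂ fun p =>
    if p.2 = 0 then
      (projDiag q p.1.N p.1.i : ℂ) • skt p.1.N p.1.i p.1.r 0
        + (projOff q p.1.N p.1.i : ℂ) • skt p.1.N (p.1.i + 1) p.1.r 1
    else
      (projOff q p.1.N (p.1.i - 1) : ℂ) • skt p.1.N (p.1.i - 1) p.1.r 0
        + ((1 - projDiag q p.1.N (p.1.i - 1) : ℝ) : ℂ) • skt p.1.N p.1.i p.1.r 1

/-- The formula for the projection also holds out of range: a coefficient vanishes whenever only one
of the two vectors is in range. -/
theorem proj_skt_plus (q : ℝ) (N i r : ℤ) : proj q (skt N i r 0)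
    = (projDiag q N i : ℂ) • skt N i r 0 + (projOff q N i : ℂ) • skt N (i + 1) r 1 := by
  by_cases h : Lawful N i r
  · rw [sbasis_lawful h, proj, Module.Basis.constr_basis]
    simp only [sbasis_apply, if_true]
  · rw [skt_of_not h, map_zero, smul_zero, zero_add]
    by_cases h' : i = -1
    · rw [projOff_left h', Complex.ofReal_zero, zero_smul]
    · rw [skt_of_not (by unfold Lawful at *; omega), smul_zero]

theorem proj_skt_minus (q : ℝ) (N i r : ℤ) : proj q (skt N i r 1)
    = (projOff q N (i - 1) : ℂ) • skt N (i - 1) r 0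
      + ((1 - projDiag q N (i - 1) : ℝ) : ℂ) • skt N i r 1 := by
  by_cases h : Lawful N i r
  · rw [sbasis_lawful h, proj, Module.Basis.constr_basis]
    simp only [sbasis_apply, if_neg one_ne_zero]
  · rw [skt_of_not h, map_zero, smul_zero, add_zero]
    by_cases h' : i = N + 1
    · rw [projOff_right (by omega), Complex.ofReal_zero, zero_smul]
    · rw [skt_of_not (by unfold Lawful at *; omega), smul_zero]

/-- The diagonal operator with eigenvalue `φ (2 l)` on the vectors of weight `l`. -/
noncomputable def diag (φ : ℤ → ℝ) : PreHilb →ₗ[ℂ] PreHilb :=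
  sbasis.constr ℂ fun p => (φ p.1.N : ℂ) • sbasis p

theorem diag_sbasis (φ : ℤ → ℝ) (p : Idx × Fin 2) :
    diag φ (sbasis p) = (φ p.1.N : ℂ) • sbasis p := sbasis.constr_basis ℂ _ _

theorem diag_skt (φ : ℤ → ℝ) (N i r : ℤ) (s : Fin 2) :
    diag φ (skt N i r s) = (φ N : ℂ) • skt N i r s := by
  by_cases h : Lawful N i r
  · rw [sbasis_lawful h, diag_sbasis]
  · rw [skt_of_not h, map_zero, smul_zero]

theorem diag_mul (φ ψ : ℤ → ℝ) : diag φ * diag ψ = diag (φ * ψ) :=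
  sbasis.ext fun p => by
    rw [Module.End.mul_apply, diag_sbasis, map_smul, diag_sbasis, diag_sbasis, smul_smul, mul_comm,
      ← Complex.ofReal_mul]; rfl

theorem diag_add (φ ψ : ℤ → ℝ) : diag φ + diag ψ = diag (φ + ψ) :=
  sbasis.ext fun p => by
    rw [LinearMap.add_apply, diag_sbasis, diag_sbasis, diag_sbasis, ← add_smul,
      ← Complex.ofReal_add]; rfl

theorem diag_one : diag 1 = 1 := sbasis.ext fun p => by simp [diag_sbasis]

theorem diag_symm (φ : ℤ → ℝ) (v w : PreHilb) :
    ⟪inclS (diag φ v), inclS w⟫_ℂ = ⟪inclS v, inclS (diag φ w)⟫_ℂ := by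
  refine symm_of_skt (fun N i r s N' i' r' s' h h' => ?_) v w
  simp only [diag_skt, map_smul, inner_smul_left, inner_smul_right, Complex.conj_ofReal,
    inner_skt_left h']
  split_ifs with e
  · rw [e.1]
  · simp

theorem proj_diag (q : ℝ) (φ : ℤ → ℝ) : proj q * diag φ = diag φ * proj q :=
  prehilb_ext fun N i r s _ => by
    rw [Module.End.mul_apply, Module.End.mul_apply, diag_skt, map_smul]
    fin_cases s
    · change (φ N : ℂ) • proj q (skt N i r 0) = diag φ (proj q (skt N i r 0))
      rw [proj_skt_plus]
      simp only [map_add, map_smul, diag_skt, smul_add]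
      congr 1 <;> exact smul_comm _ _ _
    · change (φ N : ℂ) • proj q (skt N i r 1) = diag φ (proj q (skt N i r 1))
      rw [proj_skt_minus]
      simp only [map_add, map_smul, diag_skt, smul_add]
      congr 1 <;> exact smul_comm _ _ _

theorem proj_mul_self {q : ℝ} (h0 : 0 < q) (h1 : q ≠ 1) : proj q * proj q = proj q :=
  prehilb_ext fun N i r s h => by
    obtain ⟨⟨hi, hiN⟩, hr, hrN⟩ := h
    rw [Module.End.mul_apply]
    fin_cases s
    · change proj q (proj q (skt N i r 0)) = proj q (skt N i r 0)
      have e := congrArg (fun x : ℝ => (x : ℂ) • skt N i r 0)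
        (@projOff_sq q h0 h1 N i (by omega) (by omega) (by omega))
      rw [proj_skt_plus, map_add, map_smul, map_smul, proj_skt_plus, proj_skt_minus,
        show i + 1 - 1 = i from add_sub_cancel_right i 1]
      push_cast at *
      linear_combination (norm := module) e
    · change proj q (proj q (skt N i r 1)) = proj q (skt N i r 1)
      have e := congrArg (fun x : ℝ => (x : ℂ) • skt N i r 1)
        (@projOff_sq q h0 h1 N (i - 1) (by omega) (by omega) (by omega))
      rw [proj_skt_minus, map_add, map_smul, map_smul, proj_skt_plus, proj_skt_minus,
        show i - 1 + 1 = i from sub_add_cancel i 1]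
      push_cast at *
      linear_combination (norm := module) e

theorem proj_symm (q : ℝ) (v w : PreHilb) :
    ⟪inclS (proj q v), inclS w⟫_ℂ = ⟪inclS v, inclS (proj q w)⟫_ℂ := by
  refine symm_of_skt (fun N i r s N' i' r' s' h h' => ?_) v w
  rcases (show s = 0 ∨ s = 1 by omega) with rfl | rfl <;>
    rcases (show s' = 0 ∨ s' = 1 by omega) with rfl | rfl <;>
    simp only [proj_skt_plus, proj_skt_minus, map_add, map_smul, inner_add_left, inner_add_right,
      inner_smul_left, inner_smul_right, Complex.conj_ofReal, inner_skt_left h', inner_skt_right h]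
  all_goals
    simp only [and_true, and_false, if_false, mul_zero, add_zero, zero_add, zero_ne_one, one_ne_zero]
  · by_cases e : N = N' ∧ i = i' ∧ r = r'
    · obtain ⟨rfl, rfl, rfl⟩ := e
      rfl
    · rw [if_neg e, mul_zero, mul_zero]
  · by_cases e : N = N' ∧ i + 1 = i' ∧ r = r'
    · obtain ⟨rfl, rfl, rfl⟩ := e
      simp
    · rw [if_neg e, if_neg (by omega), mul_zero, mul_zero]
  · by_cases e : N = N' ∧ i - 1 = i' ∧ r = r'
    · obtain ⟨rfl, rfl, rfl⟩ := e
      simp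
    · rw [if_neg e, if_neg (by omega), mul_zero, mul_zero]
  · by_cases e : N = N' ∧ i = i' ∧ r = r'
    · obtain ⟨rfl, rfl, rfl⟩ := e
      rfl
    · rw [if_neg e, mul_zero, mul_zero]

/-! ### Functional calculus of the Dirac operator -/

/-- The operator `φ (2 l) P + ψ (2 l) (1 - P)`, where `P` is the spectral projection. -/
noncomputable def cal (q : ℝ) (φ ψ : ℤ → ℝ) : PreHilb →ₗ[ℂ] PreHilb :=
  proj q * diag φ + (1 - proj q) * diag ψ

section cal
variable {q : ℝ}

theorem cal_mul (h0 : 0 < q) (h1 : q ≠ 1) (φ ψ φ' ψ' : ℤ → ℝ) :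
    cal q φ ψ * cal q φ' ψ' = cal q (φ * φ') (ψ * ψ') := by
  have H : ∀ u d v e : PreHilb →ₗ[ℂ] PreHilb, d * v = v * d →
      u * d * (v * e) = u * v * (d * e) := fun u d v e h => by
    rw [mul_assoc, ← mul_assoc d, h, mul_assoc v, ← mul_assoc]
  have c1 : ∀ φ, diag φ * proj q = proj q * diag φ := fun φ => (proj_diag q φ).symm
  have c2 : ∀ φ, diag φ * (1 - proj q) = (1 - proj q) * diag φ := fun φ => by
    rw [mul_sub, sub_mul, c1, one_mul, mul_one]
  have hp : IsIdempotentElem (proj q) := proj_mul_self h0 h1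
  rw [cal, cal, cal, add_mul, mul_add, mul_add, H _ _ _ _ (c1 _), H _ _ _ _ (c1 _),
    H _ _ _ _ (c2 _), H _ _ _ _ (c2 _), hp.eq, hp.one_sub.eq, hp.mul_one_sub_self,
    hp.one_sub_mul_self, diag_mul φ φ', diag_mul ψ ψ', zero_mul, zero_mul, add_zero, zero_add]

theorem cal_add (φ ψ φ' ψ' : ℤ → ℝ) : cal q φ ψ + cal q φ' ψ' = cal q (φ + φ') (ψ + ψ') := by
  rw [cal, cal, cal, ← diag_add, ← diag_add, mul_add, mul_add]
  abel

theorem cal_one : cal q 1 1 = 1 := by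
  rw [cal, diag_one, mul_one, mul_one, add_sub_cancel]

theorem cal_one_zero : cal q 1 0 = proj q := by
  have : diag 0 = 0 := sbasis.ext fun p => by simp [diag_sbasis]
  rw [cal, diag_one, this, mul_one, mul_zero, add_zero]

theorem cal_symm (φ ψ : ℤ → ℝ) (v w : PreHilb) :
    ⟪inclS (cal q φ ψ v), inclS w⟫_ℂ = ⟪inclS v, inclS (cal q φ ψ w)⟫_ℂ := by
  have h : ∀ φ v w, ⟪inclS (proj q (diag φ v)), inclS w⟫_ℂ
      = ⟪inclS v, inclS (proj q (diag φ w))⟫_ℂ := fun φ v w => by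
    rw [proj_symm, diag_symm]
    exact congrArg (fun x => ⟪inclS v, inclS x⟫_ℂ) (LinearMap.congr_fun (proj_diag q φ) w).symm
  have e : ∀ v, cal q φ ψ v = proj q (diag φ v) + (diag ψ v - proj q (diag ψ v)) := fun _ => rfl
  simp only [e, map_add, map_sub, inner_add_left, inner_sub_left, inner_add_right, inner_sub_right,
    h, diag_symm]

/-- A function of modulus at most one yields a contraction: the squares of `φ` and `√(1 - φ²)` add up
to one. -/
theorem norm_cal_le (h0 : 0 < q) (h1 : q ≠ 1) {φ ψ : ℤ → ℝ} (hφ : ∀ n, |φ n| ≤ 1)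
    (hψ : ∀ n, |ψ n| ≤ 1) (v : PreHilb) : ‖inclS (cal q φ ψ v)‖ ≤ 1 * ‖inclS v‖ := by
  have hs : ∀ φ : ℤ → ℝ, (∀ n, |φ n| ≤ 1) →
      φ * φ + (fun n => √(1 - φ n ^ 2)) * (fun n => √(1 - φ n ^ 2)) = 1 := fun φ h => by
    ext n
    have : 0 ≤ 1 - φ n ^ 2 := by
      have := (sq_le_one_iff_abs_le_one _).2 (h n)
      linarith
    simp only [Pi.add_apply, Pi.mul_apply, Real.mul_self_sqrt this, Pi.one_apply]
    ring
  have hsum : cal q φ ψ * cal q φ ψ + cal q (fun n => √(1 - φ n ^ 2)) (fun n => √(1 - ψ n ^ 2))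
      * cal q (fun n => √(1 - φ n ^ 2)) (fun n => √(1 - ψ n ^ 2)) = 1 := by
    rw [cal_mul h0 h1, cal_mul h0 h1, cal_add, hs φ hφ, hs ψ hψ, cal_one]
  have h := congrArg (fun w => ⟪inclS v, inclS w⟫_ℂ) (LinearMap.congr_fun hsum v)
  simp only [LinearMap.add_apply, Module.End.mul_apply, Module.End.one_apply, map_add,
    inner_add_right, ← cal_symm, inner_self_eq_norm_sq_to_K] at h
  have h' : ‖inclS (cal q φ ψ v)‖ ^ 2 + ‖inclS (cal q (fun n => √(1 - φ n ^ 2))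
      (fun n => √(1 - ψ n ^ 2)) v)‖ ^ 2 = ‖inclS v‖ ^ 2 := by
    apply Complex.ofReal_injective
    push_cast
    simpa using h
  rw [one_mul]
  refine le_of_sq_le_sq ?_ (norm_nonneg _)
  nlinarith [sq_nonneg ‖inclS (cal q (fun n => √(1 - φ n ^ 2)) (fun n => √(1 - ψ n ^ 2)) v)‖]

theorem norm_proj_le (h0 : 0 < q) (h1 : q ≠ 1) (v : PreHilb) :
    ‖inclS (proj q v)‖ ≤ ‖inclS v‖ := by
  simpa [cal_one_zero] using norm_cal_le h0 h1 (φ := 1) (ψ := 0) (by simp) (by simp) v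

theorem norm_one_sub_proj_le (h0 : 0 < q) (h1 : q ≠ 1) (v : PreHilb) :
    ‖inclS (v - proj q v)‖ ≤ ‖inclS v‖ := by
  have : cal q 0 1 = 1 - proj q := by
    rw [eq_sub_iff_add_eq, ← cal_one_zero, cal_add, zero_add, add_zero, cal_one]
  simpa [this] using norm_cal_le h0 h1 (φ := 0) (ψ := 1) (by simp) (by simp) v

theorem norm_cal_sbasis_le (h0 : 0 < q) (h1 : q ≠ 1) (φ ψ : ℤ → ℝ) (p : Idx × Fin 2) :
    ‖inclS (cal q φ ψ (sbasis p))‖ ≤ |φ p.1.N| + |ψ p.1.N| := by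
  have e : cal q φ ψ (sbasis p) = (φ p.1.N : ℂ) • proj q (sbasis p)
      + (ψ p.1.N : ℂ) • (sbasis p - proj q (sbasis p)) := by
    change proj q (diag φ (sbasis p)) + (diag ψ (sbasis p) - proj q (diag ψ (sbasis p))) = _
    rw [diag_sbasis, diag_sbasis, map_smul, map_smul, smul_sub]
  rw [e, map_add, map_smul, map_smul]
  refine (norm_add_le _ _).trans ?_
  rw [norm_smul, norm_smul, Complex.norm_real, Complex.norm_real, Real.norm_eq_abs,
    Real.norm_eq_abs]
  have b := norm_inclS_sbasis p
  have b1 := norm_proj_le h0 h1 (sbasis p)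
  have b2 := norm_one_sub_proj_le h0 h1 (sbasis p)
  rw [b] at b1 b2
  exact add_le_add (mul_le_of_le_one_right (abs_nonneg _) b1)
    (mul_le_of_le_one_right (abs_nonneg _) b2)

end cal

/-- The bounded extension of `cal` to the spinor Hilbert space. -/
noncomputable def calOp (q : ℝ) (φ ψ : ℤ → ℝ) : Hilb →L[ℂ] Hilb :=
  (inclS ∘ₗ cal q φ ψ).extendOfNorm inclS

section calOp
variable {q : ℝ} {φ ψ φ' ψ' : ℤ → ℝ}

theorem calOp_incl (h0 : 0 < q) (h1 : q ≠ 1) (hφ : ∀ n, |φ n| ≤ 1)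
    (hψ : ∀ n, |ψ n| ≤ 1) (v : PreHilb) : calOp q φ ψ (inclS v) = inclS (cal q φ ψ v) :=
  LinearMap.extendOfNorm_eq inclS_dense ⟨1, norm_cal_le h0 h1 hφ hψ⟩ v

theorem calOp_mul (h0 : 0 < q) (h1 : q ≠ 1) (hφ : ∀ n, |φ n| ≤ 1) (hψ : ∀ n, |ψ n| ≤ 1)
    (hφ' : ∀ n, |φ' n| ≤ 1) (hψ' : ∀ n, |ψ' n| ≤ 1) :
    calOp q φ ψ * calOp q φ' ψ' = calOp q (φ * φ') (ψ * ψ') :=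
  eq_of_denseRange inclS_dense fun v => by
    have h : ∀ {φ φ' : ℤ → ℝ}, (∀ n, |φ n| ≤ 1) → (∀ n, |φ' n| ≤ 1) → ∀ n, |(φ * φ') n| ≤ 1 :=
      fun h h' n => by
        rw [Pi.mul_apply, abs_mul]
        exact mul_le_one₀ (h n) (abs_nonneg _) (h' n)
    change calOp q φ ψ (calOp q φ' ψ' (inclS v)) = _
    rw [calOp_incl h0 h1 hφ' hψ', calOp_incl h0 h1 hφ hψ,
      calOp_incl h0 h1 (h hφ hφ') (h hψ hψ'), ← cal_mul h0 h1, Module.End.mul_apply]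

theorem calOp_isSelfAdjoint (h0 : 0 < q) (h1 : q ≠ 1) (hφ : ∀ n, |φ n| ≤ 1)
    (hψ : ∀ n, |ψ n| ≤ 1) : IsSelfAdjoint (calOp q φ ψ) :=
  eq_of_denseRange inclS_dense fun v => by
    refine inclS_dense.eq_of_inner_left (𝕜 := ℂ) fun w => ?_
    rw [ContinuousLinearMap.star_eq_adjoint, ContinuousLinearMap.adjoint_inner_left,
      calOp_incl h0 h1 hφ hψ, calOp_incl h0 h1 hφ hψ, cal_symm]

/-- The operator of a nonnegative function is positive, being the square of a self-adjoint one. -/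
theorem calOp_isPositive (h0 : 0 < q) (h1 : q ≠ 1) (hφ : ∀ n, 0 ≤ φ n ∧ φ n ≤ 1)
    (hψ : ∀ n, 0 ≤ ψ n ∧ ψ n ≤ 1) : (calOp q φ ψ).IsPositive := by
  have h : ∀ {φ : ℤ → ℝ}, (∀ n, 0 ≤ φ n ∧ φ n ≤ 1) → ∀ n, |(fun n => √(φ n)) n| ≤ 1 :=
    fun h n => by
      rw [abs_of_nonneg (Real.sqrt_nonneg _)]
      exact Real.sqrt_le_one.2 (h n).2
  have e : ∀ {φ : ℤ → ℝ}, (∀ n, 0 ≤ φ n ∧ φ n ≤ 1) →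
      (fun n => √(φ n)) * (fun n => √(φ n)) = φ := fun h => by
    ext n
    exact Real.mul_self_sqrt (h n).1
  have hm := calOp_mul h0 h1 (h hφ) (h hψ) (h hφ) (h hψ)
  rw [e hφ, e hψ] at hm
  have hs := calOp_isSelfAdjoint h0 h1 (h hφ) (h hψ)
  rw [← ContinuousLinearMap.nonneg_iff_isPositive, ← hm]
  nth_rewrite 1 [← hs.star_eq]
  exact star_mul_self_nonneg _

end calOp

/-! ### Diagonalisation of the Dirac operator -/

section dirac
variable {q : ℝ}

/-- The formulas for the ladder operators hold out of range, where both sides vanish. -/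
theorem actE_ket (q : ℝ) (N i r : ℤ) : actE q (ket N i r)
    = ((√(qInt q (N - i) * qInt q (i + 1)) : ℝ) : ℂ) • ket N (i + 1) r := by
  by_cases h : Lawful N i r
  · rw [ket_lawful h, actE, Finsupp.linearCombination_single, one_smul]
  · rw [show ket N i r = 0 from dif_neg h, map_zero]
    by_cases h' : i = -1
    · simp [h', qInt_zero]
    · rw [show ket N (i + 1) r = 0 from dif_neg (by unfold Lawful at h; omega), smul_zero]

theorem actF_ket (q : ℝ) (N i r : ℤ) : actF q (ket N i r)
    = ((√(qInt q (N - i + 1) * qInt q i) : ℝ) : ℂ) • ket N (i - 1) r := by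
  by_cases h : Lawful N i r
  · rw [ket_lawful h, actF, Finsupp.linearCombination_single, one_smul]
  · rw [show ket N i r = 0 from dif_neg h, map_zero]
    by_cases h' : i = N + 1
    · simp [h', qInt_zero]
    · rw [show ket N (i - 1) r = 0 from dif_neg (by unfold Lawful at h; omega), smul_zero]

theorem actKinv_ket (q : ℝ) (N i r : ℤ) : actKinv q (ket N i r)
    = ((√q ^ (N - 2 * i) : ℝ) : ℂ) • ket N i r := by
  by_cases h : Lawful N i r
  · rw [ket_lawful h, actKinv, Finsupp.linearCombination_single, one_smul, ← ket_lawful h]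
  · rw [show ket N i r = 0 from dif_neg h, map_zero, smul_zero]

theorem psiPlus_single (q : ℝ) : Matrix.toLin' (psiPlus q) (Pi.single 0 1) = 0 ∧
    Matrix.toLin' (psiPlus q) (Pi.single 1 1) = ((√q : ℝ) : ℂ) • (Pi.single 0 1 : Fin 2 → ℂ) := by
  constructor <;> ext s <;> fin_cases s <;> simp [psiPlus, Matrix.toLin'_apply, Matrix.mulVec]

theorem psiMinus_single (q : ℝ) :
    Matrix.toLin' (psiMinus q) (Pi.single 0 1) = (-(√(q⁻¹) : ℝ) : ℂ) • (Pi.single 1 1 : Fin 2 → ℂ) ∧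
    Matrix.toLin' (psiMinus q) (Pi.single 1 1) = 0 := by
  constructor <;> ext s <;> fin_cases s <;> simp [psiMinus, Matrix.toLin'_apply, Matrix.mulVec]

theorem psiZero_single (q : ℝ) :
    Matrix.toLin' (psiZero q) (Pi.single 0 1)
      = ((-((√(qInt q 2))⁻¹ * q⁻¹) : ℝ) : ℂ) • (Pi.single 0 1 : Fin 2 → ℂ) ∧
    Matrix.toLin' (psiZero q) (Pi.single 1 1)
      = (((√(qInt q 2))⁻¹ * q : ℝ) : ℂ) • (Pi.single 1 1 : Fin 2 → ℂ) := by
  constructor <;> ext s <;> fin_cases s <;> simp [psiZero, Matrix.toLin'_apply, Matrix.mulVec]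

/-- The eigenvalue of `q⁻¹ f e - q e f` on `|N, i, r⟩`. -/
noncomputable def eigY (q : ℝ) (N i : ℤ) : ℝ :=
  q⁻¹ * (qInt q (N - i) * qInt q (i + 1)) - q * (qInt q (N - i + 1) * qInt q i)

theorem Zzero_ket (h0 : 0 < q) (h1 : q ≠ 1) {N i r : ℤ} (h : Lawful N i r) :
    Zzero q (ket N i r) = (((√(qInt q 2))⁻¹ * eigY q N i : ℝ) : ℂ) • ket N i r := by
  obtain ⟨⟨hi, hiN⟩, -⟩ := h
  have P := fun n hn => @qInt_nonneg q h0 h1 n hn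
  have s1 := Real.mul_self_sqrt (mul_nonneg (P (N - i) (by omega)) (P (i + 1) (by omega)))
  have s2 := Real.mul_self_sqrt (mul_nonneg (P (N - i + 1) (by omega)) (P i (by omega)))
  simp only [Zzero, LinearMap.smul_apply, LinearMap.sub_apply, LinearMap.comp_apply, actE_ket,
    actF_ket, map_smul, smul_smul, ← Complex.ofReal_mul, show i + 1 - 1 = i by ring,
    show i - 1 + 1 = i by ring, show N - (i + 1) + 1 = N - i by ring,
    show N - (i - 1) = N - i + 1 by ring, s1, s2, ← sub_smul, ← Complex.ofReal_sub]
  rw [eigY]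

theorem sqrt_pow_four_sub_one_ne (h0 : 0 < q) (h1 : q ≠ 1) : √q ^ 4 - 1 ≠ 0 := fun h => by
  have hQ := (Real.sqrt_pos.2 h0).ne'
  refine w_ne h0 h1 ?_
  field_simp
  linear_combination h

/-- The diagonal matrix entries of the Dirac operator, in terms of its eigenvalues. -/
theorem projDiag_eig (h0 : 0 < q) (h1 : q ≠ 1) {N i : ℤ} (hN : 0 ≤ N) :
    qInt q N * projDiag q N i - qInt q (N + 2) * (1 - projDiag q N i) = -(q⁻¹ * eigY q N i) ∧
    qInt q N * (1 - projDiag q N i) - qInt q (N + 2) * projDiag q N i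
      = q * eigY q N (i + 1) := by
  have hQ := (Real.sqrt_pos.2 h0).ne'
  have n1 := (@qInt_pos q h0 h1 (N + 1) (by omega)).ne'
  have w := sqrt_pow_four_sub_one_ne h0 h1
  have hq : q = √q ^ 2 := (Real.sq_sqrt h0.le).symm
  have a1 := zpow_ne_zero i hQ
  have a3 := zpow_ne_zero N hQ
  have a0 := h0.ne'
  rw [one_sub_projDiag h0 h1 hN, projDiag, eigY, eigY, mul_div_assoc', mul_div_assoc',
    mul_div_assoc', mul_div_assoc', ← sub_div, ← sub_div, div_eq_iff n1, div_eq_iff n1]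
  simp only [qInt_eq h0, q_zpow h0, zpow_add₀ hQ, zpow_sub₀ hQ, zpow_neg, zpow_ofNat]
  clear n1 h0 h1
  generalize √q ^ i = x at *
  generalize √q ^ N = z at *
  generalize √q = Q at *
  subst hq
  constructor <;> field_simp <;> ring

/-- The off-diagonal matrix entries of the Dirac operator, in terms of its eigenvalues. -/
theorem projOff_eig (h0 : 0 < q) (h1 : q ≠ 1) {N i : ℤ} (h : i ≤ N) (hN : 0 ≤ N) :
    (qInt q N + qInt q (N + 2)) * projOff q N i
      = qInt q 2 * √q ^ (N - 2 * i - 1) * √(qInt q (N - i) * qInt q (i + 1)) := by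
  have hQ := (Real.sqrt_pos.2 h0).ne'
  have n1 := (@qInt_pos q h0 h1 (N + 1) (by omega)).ne'
  have w := sqrt_pow_four_sub_one_ne h0 h1
  have e : qInt q N + qInt q (N + 2) = qInt q 2 * qInt q (N + 1) := by
    simp only [qInt_eq h0, zpow_add₀ hQ, zpow_ofNat]
    have a3 := zpow_ne_zero N hQ
    generalize √q ^ N = z at *
    generalize √q = Q at *
    field_simp
    ring
  rw [e, projOff, Real.sqrt_mul (qInt_nonneg h0 h1 (by omega))]
  field_simp

/-- The Dirac operator has the eigenvalues `[2 l]` and `-[2 l + 2]`. -/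
theorem dirac_eq_cal (h0 : 0 < q) (h1 : q ≠ 1) :
    dirac q = cal q (fun N => qInt q N) (fun N => -qInt q (N + 2)) := by
  refine prehilb_ext fun N i r s h => ?_
  have hN : 0 ≤ N := h.1.1.trans h.1.2
  have hQ := (Real.sqrt_pos.2 h0).ne'
  have p2 := @qInt_pos q h0 h1 2 (by norm_num)
  have s2 : qInt q 2 * ((√(qInt q 2))⁻¹ * (√(qInt q 2))⁻¹) = 1 := by
    rw [← mul_inv, Real.mul_self_sqrt p2.le, mul_inv_cancel₀ p2.ne']
  have e : ∀ v, cal q (fun N => qInt q N) (fun N => -qInt q (N + 2)) v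
      = proj q (diag (fun N => qInt q N) v) + (diag (fun N => -qInt q (N + 2)) v
        - proj q (diag (fun N => -qInt q (N + 2)) v)) := fun _ => rfl
  rw [e]
  simp only [diag_skt, map_smul]
  rcases (show s = 0 ∨ s = 1 by omega) with rfl | rfl
  · rw [proj_skt_plus]
    have hd : dirac q (skt N i r 0)
        = ((qInt q 2 * √q ^ (N - 2 * i - 1) * √(qInt q (N - i) * qInt q (i + 1)) : ℝ) : ℂ) •
            skt N (i + 1) r 1 + ((-(q⁻¹ * eigY q N i) : ℝ) : ℂ) • skt N i r 0 := by
      simp only [dirac, LinearMap.add_apply, LinearMap.smul_apply, skt, TensorProduct.map_tmul,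
        psiPlus_single, psiMinus_single, psiZero_single, Zplus, Zzero_ket h0 h1 h,
        LinearMap.comp_apply, actE_ket, actKinv_ket, map_smul, TensorProduct.tmul_zero, smul_zero,
        add_zero, TensorProduct.smul_tmul', TensorProduct.tmul_smul, smul_smul]
      have e1 : -(q * qInt q 2) * (-√(q⁻¹) * (√(qInt q (N - i) * qInt q (i + 1))
          * √q ^ (N - 2 * (i + 1))))
          = qInt q 2 * √q ^ (N - 2 * i - 1) * √(qInt q (N - i) * qInt q (i + 1)) := by
        rw [show N - 2 * i - 1 = 1 + (N - 2 * (i + 1)) by ring, zpow_one_add₀ hQ, Real.sqrt_inv]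
        field_simp
        rw [Real.sq_sqrt h0.le]
      have e2 : qInt q 2 * (-((√(qInt q 2))⁻¹ * q⁻¹) * ((√(qInt q 2))⁻¹ * eigY q N i))
          = -(q⁻¹ * eigY q N i) := by
        linear_combination -(q⁻¹ * eigY q N i) * s2
      rw [← e1, ← e2]
      push_cast
      rfl
    rw [hd, ← projOff_eig h0 h1 (by have := h.1; omega) hN, ← (projDiag_eig h0 h1 hN).1]
    push_cast
    module
  · rw [proj_skt_minus]
    have hd : dirac q (skt N i r 1)
        = ((qInt q 2 * √q ^ (N - 2 * (i - 1) - 1) * √(qInt q (N - (i - 1)) * qInt q (i - 1 + 1)) : ℝ)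
          : ℂ) • skt N (i - 1) r 0 + ((q * eigY q N (i - 1 + 1) : ℝ) : ℂ) • skt N i r 1 := by
      simp only [dirac, LinearMap.add_apply, LinearMap.smul_apply, skt, TensorProduct.map_tmul,
        psiPlus_single, psiMinus_single, psiZero_single, Zminus, Zzero_ket h0 h1 h,
        LinearMap.neg_apply, LinearMap.comp_apply, actF_ket, actKinv_ket, map_smul,
        TensorProduct.tmul_zero, smul_zero,
        TensorProduct.smul_tmul', TensorProduct.tmul_smul, smul_smul]
      have e1 : -(q⁻¹ * qInt q 2) * √q * -(√(qInt q (N - i + 1) * qInt q i)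
          * √q ^ (N - 2 * (i - 1))) = qInt q 2 * √q ^ (N - 2 * (i - 1) - 1)
          * √(qInt q (N - (i - 1)) * qInt q (i - 1 + 1)) := by
        rw [zpow_sub_one₀ hQ, show N - (i - 1) = N - i + 1 by ring, show i - 1 + 1 = i by ring]
        field_simp
        rw [Real.sq_sqrt h0.le]
      have e2 : qInt q 2 * (((√(qInt q 2))⁻¹ * q) * ((√(qInt q 2))⁻¹ * eigY q N i))
          = q * eigY q N (i - 1 + 1) := by
        rw [sub_add_cancel]
        linear_combination (q * eigY q N i) * s2
      rw [← e1, ← e2, zero_add, add_comm, ← neg_smul, smul_smul]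
      push_cast
      rfl
    rw [hd, ← projOff_eig h0 h1 (by have := h.1; omega) hN, ← (projDiag_eig h0 h1 hN).2]
    push_cast
    module

end dirac

/-! ### The bounded transform of the Dirac operator -/

section transform
variable {q : ℝ}

/-- The function `(1 + x²)^{-1/2}`. -/
noncomputable def resolv (x : ℝ) : ℝ := (√(1 + x ^ 2))⁻¹

/-- The function `x (1 + x²)^{-1/2}`. -/
noncomputable def bdd (x : ℝ) : ℝ := x * resolv x

theorem resolv_sq (x : ℝ) : resolv x ^ 2 * (1 + x ^ 2) = 1 := by
  have h : 0 < 1 + x ^ 2 := by positivity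
  rw [resolv, inv_pow, Real.sq_sqrt h.le, inv_mul_cancel₀ h.ne']

theorem resolv_pos (x : ℝ) : 0 < resolv x := by
  rw [resolv]; positivity

theorem resolv_le_one (x : ℝ) : resolv x ≤ 1 := by
  have := resolv_sq x
  nlinarith [resolv_pos x, sq_nonneg x, sq_nonneg (resolv x * x)]

theorem one_sub_bdd_sq (x : ℝ) : 1 - bdd x ^ 2 = resolv x ^ 2 := by
  rw [bdd]
  linear_combination -resolv_sq x

theorem abs_bdd_le_one (x : ℝ) : |bdd x| ≤ 1 := by
  rw [← sq_le_one_iff_abs_le_one]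
  nlinarith [one_sub_bdd_sq x, sq_nonneg (resolv x)]

/-- The operator `F = D (1 + D²)^{-1/2}`. -/
noncomputable def diracF (q : ℝ) : Hilb →L[ℂ] Hilb :=
  calOp q (fun N => bdd (qInt q N)) (fun N => bdd (-qInt q (N + 2)))

theorem isBoundedTransform_dirac_iff (h0 : 0 < q) (h1 : q ≠ 1) (F' : Hilb →L[ℂ] Hilb) :
    IsBoundedTransform inclS (dirac q) F' ↔ F' = diracF q := by
  have hres : ∀ x, |resolv x| ≤ 1 := fun x => by
    rw [abs_of_pos (resolv_pos x)]; exact resolv_le_one x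
  have hD := dirac_eq_cal h0 h1
  have hsq : ∀ v, v + dirac q (dirac q v)
      = cal q (fun N => 1 + qInt q N ^ 2) (fun N => 1 + (-qInt q (N + 2)) ^ 2) v := fun v => by
    have : 1 + dirac q * dirac q
        = cal q (fun N => 1 + qInt q N ^ 2) (fun N => 1 + (-qInt q (N + 2)) ^ 2) := by
      rw [hD, cal_mul h0 h1, ← cal_one, cal_add]
      congr 1 <;> ext n <;> simp [pow_two]
    exact LinearMap.congr_fun this v
  have happ : ∀ φ ψ φ' ψ' v, cal q φ ψ (cal q φ' ψ' v) = cal q (φ * φ') (ψ * ψ') v :=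
    fun φ ψ φ' ψ' v => LinearMap.congr_fun (cal_mul h0 h1 φ ψ φ' ψ') v
  have hone : ∀ v, cal q 1 1 v = v := fun v => LinearMap.congr_fun cal_one v
  refine isBoundedTransform_iff inclS_dense ?_
    (R := calOp q (fun N => resolv (qInt q N)) (fun N => resolv (-qInt q (N + 2))))
    (calOp_isPositive h0 h1 (fun n => ⟨(resolv_pos _).le, resolv_le_one _⟩)
      (fun n => ⟨(resolv_pos _).le, resolv_le_one _⟩)) ?_ ?_ ?_ F'
  · rw [hD]
    exact cal_symm _ _
  · intro v
    rw [calOp_incl h0 h1 (fun _ => hres _) (fun _ => hres _),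
      calOp_incl h0 h1 (fun _ => hres _) (fun _ => hres _), hsq, happ, happ]
    congr 1
    convert hone v using 3 <;> ext n <;>
      simp only [Pi.mul_apply, Pi.one_apply, ← pow_two] <;> exact resolv_sq _
  · intro w
    refine ⟨cal q (fun N => resolv (qInt q N) ^ 2) (fun N => resolv (-qInt q (N + 2)) ^ 2) w, ?_⟩
    rw [hsq, happ]
    convert hone w using 3 <;> ext n <;>
      exact (mul_comm _ _).trans (resolv_sq _)
  · intro v
    refine ⟨cal q (fun N => resolv (qInt q N)) (fun N => resolv (-qInt q (N + 2))) v,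
      calOp_incl h0 h1 (fun _ => hres _) (fun _ => hres _) v, ?_⟩
    rw [diracF, calOp_incl h0 h1 (fun _ => abs_bdd_le_one _) (fun _ => abs_bdd_le_one _), hD, happ]
    rfl

end transform

/-! ### Commutation defects of the spectral projection -/

section defects
variable {q : ℝ}

theorem qInt_cross (h0 : 0 < q) (h1 : q ≠ 1) (a b : ℤ) :
    qInt q (a + 1) * qInt q b - qInt q a * qInt q (b + 1) = qInt q (b - a) := by
  have hQ := (Real.sqrt_pos.2 h0).ne'
  have w := sqrt_pow_four_sub_one_ne h0 h1
  simp only [qInt_eq h0, zpow_add₀ hQ, zpow_sub₀ hQ, zpow_one]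
  have a1 := zpow_ne_zero a hQ
  have a3 := zpow_ne_zero b hQ
  generalize √q ^ a = x at *
  generalize √q ^ b = z at *
  generalize √q = Q at *
  field_simp
  ring

theorem qInt_succ_sub (h0 : 0 < q) (h1 : q ≠ 1) (n : ℤ) :
    qInt q (n + 1) - q * qInt q n = q ^ (-n) ∧ qInt q n - q * qInt q (n + 1) = -q ^ (n + 1) := by
  have hQ := (Real.sqrt_pos.2 h0).ne'
  have w := sqrt_pow_four_sub_one_ne h0 h1
  have hq : q = √q ^ 2 := (Real.sq_sqrt h0.le).symm
  simp only [qInt_eq h0, q_zpow h0, zpow_add₀ hQ, zpow_neg, zpow_one]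
  have a1 := zpow_ne_zero n hQ
  clear h0 h1
  generalize √q ^ n = x at *
  generalize √q = Q at *
  subst hq
  constructor <;> field_simp <;> ring

theorem projDiag_up (h0 : 0 < q) (h1 : q ≠ 1) {N : ℤ} (hN : 0 ≤ N) (i : ℤ) :
    projDiag q (N + 1) (i + 1) - projDiag q N i
      = q ^ (N - i) * qInt q (N - i) * (qInt q (N + 1))⁻¹ * (qInt q (N + 2))⁻¹ := by
  have n1 := (@qInt_pos q h0 h1 (N + 1) (by omega)).ne'
  have n2 := (@qInt_pos q h0 h1 (N + 2) (by omega)).ne'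
  have c := qInt_cross h0 h1 (i + 1) (N + 1)
  simp only [show N + 1 + 1 = N + 2 by ring, show N + 1 - (i + 1) = N - i by ring] at c
  rw [projDiag, projDiag, ← c, show N + 1 + 1 = N + 2 by ring,
    show N + 1 - (i + 1) = N - i by ring]
  field_simp

theorem projDiag_down (h0 : 0 < q) (h1 : q ≠ 1) {N : ℤ} (hN : 1 ≤ N) (i : ℤ) :
    projDiag q (N - 1) i - projDiag q N i
      = q ^ (-i - 1) * qInt q (i + 1) * (qInt q N)⁻¹ * (qInt q (N + 1))⁻¹ := by
  have n1 := (@qInt_pos q h0 h1 (N + 1) (by omega)).ne'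
  have n0 := (@qInt_pos q h0 h1 N (by omega)).ne'
  have c := (qInt_succ_sub h0 h1 N).1
  have e1 : q ^ (N - i) = q * q ^ (N - i - 1) := by
    rw [← zpow_one_add₀ h0.ne']; congr 1; ring
  have e2 : q ^ (-i - 1) = q ^ (N - i - 1) * q ^ (-N) := by
    rw [← zpow_add₀ h0.ne']; congr 1; ring
  rw [projDiag, projDiag, e2, e1, ← c, show N - 1 + 1 = N by ring,
    show N - 1 - i = N - i - 1 by ring]
  field_simp

/-- The coefficient of a part of a left multiplication which raises `l`; its dependence on the second
index is comprised in `g`. -/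
noncomputable def wUp (q : ℝ) (N i : ℤ) (g : ℝ) : ℝ := √q ^ (i - N) * √(qInt q (i + 1)) * g

/-- The coefficient of a part of a left multiplication which lowers `l`; its dependence on the second
index is comprised in `g`. -/
noncomputable def wDown (q : ℝ) (N i : ℤ) (g : ℝ) : ℝ := √q ^ i * √(qInt q (N - i)) * g

theorem q_mul_sqrt_zpow (h0 : 0 < q) (e : ℤ) : q * √q ^ e = √q ^ (e + 2) := by
  rw [zpow_add₀ (Real.sqrt_pos.2 h0).ne', zpow_ofNat, Real.sq_sqrt h0.le, mul_comm]

theorem sqrt_zpow_mul (h0 : 0 < q) (e n : ℤ) : √q ^ e * q ^ n = √q ^ (e + 2 * n) := by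
  have hQ := (Real.sqrt_pos.2 h0).ne'
  rw [q_zpow h0, ← zpow_natCast, ← zpow_mul, ← zpow_add₀ hQ]
  congr 1; push_cast; ring

/-! The off-diagonal defects. The label `plus` or `minus` is the spin of the source, `up` or `down` tells
whether `l` is raised or lowered. -/

theorem off_plus_up (h0 : 0 < q) (h1 : q ≠ 1) {N : ℤ} (hN : 0 ≤ N) (i : ℤ) (g : ℝ) :
    wUp q N i g * projOff q (N + 1) (i + 1) - projOff q N i * wUp q N (i + 1) g
      = -(√q ^ (2 * N - i + 2) * √(qInt q (N - i)) * √(qInt q (i + 1)) * √(qInt q (i + 2))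
        * (qInt q (N + 1))⁻¹ * (qInt q (N + 2))⁻¹ * g) := by
  have hQ := (Real.sqrt_pos.2 h0).ne'
  have n1 := (@qInt_pos q h0 h1 (N + 1) (by omega)).ne'
  have n2 := (@qInt_pos q h0 h1 (N + 2) (by omega)).ne'
  have c := (qInt_succ_sub h0 h1 (N + 1)).2
  rw [show N + 1 + 1 = N + 2 by ring] at c
  have e1 : √q ^ (i - N) * √q ^ (N + 1 - 2 * (i + 1) - 1) = √q ^ (-i - 2) := by
    rw [← zpow_add₀ hQ]; congr 1; ring
  have e2 : √q ^ (N - 2 * i - 1) * √q ^ (i + 1 - N) = q * √q ^ (-i - 2) := by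
    rw [← zpow_add₀ hQ, q_mul_sqrt_zpow h0]; congr 1; ring
  have e3 : √q ^ (2 * N - i + 2) = √q ^ (-i - 2) * q ^ (N + 2) := by
    rw [sqrt_zpow_mul h0]; congr 1; ring
  have e4 : q ^ (N + 2) = q * qInt q (N + 2) - qInt q (N + 1) := by linear_combination c
  rw [e3, e4]
  simp only [wUp, projOff, show N + 1 + 1 = N + 2 by ring, show i + 1 + 1 = i + 2 by ring,
    show N + 1 - (i + 1) = N - i by ring]
  generalize √(qInt q (N - i)) = S1 at *
  generalize √(qInt q (i + 1)) = S2 at *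
  generalize √(qInt q (i + 2)) = S3 at *
  calc _ = S1 * S2 * S3 * g * ((√q ^ (i - N) * √q ^ (N + 1 - 2 * (i + 1) - 1)) / qInt q (N + 2)
        - (√q ^ (N - 2 * i - 1) * √q ^ (i + 1 - N)) / qInt q (N + 1)) := by ring
    _ = _ := by
      rw [e1, e2]
      field_simp
      ring

theorem off_plus_down (h0 : 0 < q) (h1 : q ≠ 1) {N : ℤ} (hN : 1 ≤ N) (i : ℤ) (g : ℝ) :
    wDown q N i g * projOff q (N - 1) i - projOff q N i * wDown q N (i + 1) g
      = √q ^ (-N - i - 2) * √(qInt q (N - i)) * √(qInt q (N - i - 1)) * √(qInt q (i + 1))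
        * (qInt q N)⁻¹ * (qInt q (N + 1))⁻¹ * g := by
  have hQ := (Real.sqrt_pos.2 h0).ne'
  have n1 := (@qInt_pos q h0 h1 (N + 1) (by omega)).ne'
  have n0 := (@qInt_pos q h0 h1 N (by omega)).ne'
  have c := (qInt_succ_sub h0 h1 N).1
  have e1 : √q ^ i * √q ^ (N - 1 - 2 * i - 1) = √q ^ (N - i - 2) := by
    rw [← zpow_add₀ hQ]; congr 1; ring
  have e2 : √q ^ (N - 2 * i - 1) * √q ^ (i + 1) = q * √q ^ (N - i - 2) := by
    rw [← zpow_add₀ hQ, q_mul_sqrt_zpow h0]; congr 1; ring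
  have e3 : √q ^ (-N - i - 2) = √q ^ (N - i - 2) * q ^ (-N) := by
    rw [sqrt_zpow_mul h0]; congr 1; ring
  rw [e3, ← c]
  simp only [wDown, projOff, show N - 1 + 1 = N by ring, show N - 1 - i = N - i - 1 by ring,
    show N - (i + 1) = N - i - 1 by ring]
  generalize √(qInt q (N - i)) = S1 at *
  generalize √(qInt q (i + 1)) = S2 at *
  generalize √(qInt q (N - i - 1)) = S3 at *
  calc _ = S1 * S2 * S3 * g * ((√q ^ i * √q ^ (N - 1 - 2 * i - 1)) / qInt q N
        - (√q ^ (N - 2 * i - 1) * √q ^ (i + 1)) / qInt q (N + 1)) := by ring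
    _ = _ := by
      rw [e1, e2]
      field_simp

theorem off_minus_up (h0 : 0 < q) (h1 : q ≠ 1) {N i : ℤ} (hN : 0 ≤ N) (hi : 0 ≤ i) (g : ℝ) :
    wUp q N i g * projOff q (N + 1) i - projOff q N (i - 1) * wUp q N (i - 1) g
      = √q ^ (-i) * √(qInt q (N - i + 1)) * qInt q (N - i + 1)
        * (qInt q (N + 1))⁻¹ * (qInt q (N + 2))⁻¹ * g := by
  have hQ := (Real.sqrt_pos.2 h0).ne'
  have n1 := (@qInt_pos q h0 h1 (N + 1) (by omega)).ne'
  have n2 := (@qInt_pos q h0 h1 (N + 2) (by omega)).ne'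
  have s1 := Real.mul_self_sqrt (@qInt_nonneg q h0 h1 (i + 1) (by omega))
  have s2 := Real.mul_self_sqrt (@qInt_nonneg q h0 h1 i (by omega))
  have c := qInt_cross h0 h1 i (N + 1)
  rw [show N + 1 + 1 = N + 2 by ring, show N + 1 - i = N - i + 1 by ring] at c
  have e1 : √q ^ (i - N) * √q ^ (N + 1 - 2 * i - 1) = √q ^ (-i) := by
    rw [← zpow_add₀ hQ]; congr 1; ring
  have e2 : √q ^ (N - 2 * (i - 1) - 1) * √q ^ (i - 1 - N) = √q ^ (-i) := by
    rw [← zpow_add₀ hQ]; congr 1; ring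
  simp only [wUp, projOff, show N + 1 + 1 = N + 2 by ring, show i - 1 + 1 = i by ring,
    show N + 1 - i = N - i + 1 by ring, show N - (i - 1) = N - i + 1 by ring]
  generalize √(qInt q (N - i + 1)) = S at *
  calc _ = S * g * ((√q ^ (i - N) * √q ^ (N + 1 - 2 * i - 1))
          * (√(qInt q (i + 1)) * √(qInt q (i + 1))) / qInt q (N + 2)
        - (√q ^ (N - 2 * (i - 1) - 1) * √q ^ (i - 1 - N)) * (√(qInt q i) * √(qInt q i))
          / qInt q (N + 1)) := by ring
    _ = _ := by
      rw [e1, e2, s1, s2, ← c]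
      field_simp

theorem off_minus_down (h0 : 0 < q) (h1 : q ≠ 1) {N i : ℤ} (hN : 1 ≤ N) (hi : i ≤ N) (g : ℝ) :
    wDown q N i g * projOff q (N - 1) (i - 1) - projOff q N (i - 1) * wDown q N (i - 1) g
      = -(√q ^ (N - i) * √(qInt q i) * qInt q i * (qInt q N)⁻¹ * (qInt q (N + 1))⁻¹ * g) := by
  have hQ := (Real.sqrt_pos.2 h0).ne'
  have n1 := (@qInt_pos q h0 h1 (N + 1) (by omega)).ne'
  have n0 := (@qInt_pos q h0 h1 N (by omega)).ne'
  have s1 := Real.mul_self_sqrt (@qInt_nonneg q h0 h1 (N - i) (by omega))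
  have s2 := Real.mul_self_sqrt (@qInt_nonneg q h0 h1 (N - i + 1) (by omega))
  have c := qInt_cross h0 h1 (N - i) N
  rw [show N - (N - i) = i by ring] at c
  have e1 : √q ^ i * √q ^ (N - 1 - 2 * (i - 1) - 1) = √q ^ (N - i) := by
    rw [← zpow_add₀ hQ]; congr 1; ring
  have e2 : √q ^ (N - 2 * (i - 1) - 1) * √q ^ (i - 1) = √q ^ (N - i) := by
    rw [← zpow_add₀ hQ]; congr 1; ring
  simp only [wDown, projOff, show N - 1 + 1 = N by ring, show i - 1 + 1 = i by ring,
    show N - 1 - (i - 1) = N - i by ring, show N - (i - 1) = N - i + 1 by ring]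
  generalize √(qInt q i) = S at *
  calc _ = S * g * ((√q ^ i * √q ^ (N - 1 - 2 * (i - 1) - 1))
          * (√(qInt q (N - i)) * √(qInt q (N - i))) / qInt q N
        - (√q ^ (N - 2 * (i - 1) - 1) * √q ^ (i - 1))
          * (√(qInt q (N - i + 1)) * √(qInt q (N - i + 1))) / qInt q (N + 1)) := by ring
    _ = _ := by
      rw [e1, e2, s1, s2, ← c]
      field_simp
      ring

end defects

/-! ### Decay estimates -/

/-- The number `z` is at most `C τ ^ k` in modulus. -/
def DecayBound (τ C : ℝ) (k : ℤ) (z : ℝ) : Prop := |z| ≤ C * τ ^ k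

section decay
variable {τ C C' z z' : ℝ} {k k' : ℤ}

theorem DecayBound.mul (hτ : 0 < τ) (h : DecayBound τ C k z) (h' : DecayBound τ C' k' z') :
    DecayBound τ (C * C') (k + k') (z * z') := by
  unfold DecayBound at *
  rw [abs_mul, zpow_add₀ hτ.ne', mul_mul_mul_comm]
  exact mul_le_mul h h' (abs_nonneg _) ((abs_nonneg _).trans h)

theorem DecayBound.mono (hτ : 0 < τ) (h1 : τ ≤ 1) (h : DecayBound τ C k z) (hk : k' ≤ k) :
    DecayBound τ C k' z := by
  have hC : 0 ≤ C := nonneg_of_mul_nonneg_left ((abs_nonneg _).trans h) (zpow_pos hτ _)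
  exact h.trans (mul_le_mul_of_nonneg_left (zpow_le_zpow_right_of_le_one₀ hτ h1 hk) hC)

theorem DecayBound.neg (h : DecayBound τ C k z) : DecayBound τ C k (-z) := by
  rwa [DecayBound, abs_neg]

end decay

/-- The growth of the powers of `q` and of the `q`-integers, in terms of a number `τ`, which will be
the smaller one of `√q` and `1 / √q`. The bounds are insensitive to the exchange of `q` and `1 / q`.
For `n = 0` the last one refers to `0⁻¹ = 0`. -/
structure Growth (q τ C : ℝ) : Prop where
  pos : 0 < τ
  lt_one : τ < 1
  zpow : ∀ e m : ℤ, -m ≤ e → e ≤ m → DecayBound τ 1 (-m) (√q ^ e)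
  sqrt : ∀ n : ℤ, 0 ≤ n → DecayBound τ C (-n) √(qInt q n)
  inv_sqrt : ∀ n : ℤ, 0 ≤ n → DecayBound τ C n (√(qInt q n))⁻¹

theorem qInt_inv (q : ℝ) (n : ℤ) : qInt q⁻¹ n = qInt q n := by
  rw [qInt, qInt, inv_inv, inv_zpow', inv_zpow', neg_neg, ← neg_sub (q ^ n), ← neg_sub q,
    neg_div_neg_eq]

theorem Growth.of_lt_one {q : ℝ} (h0 : 0 < q) (h1 : q < 1) : ∃ C, Growth q √q C := by
  have hQ : 0 < √q := Real.sqrt_pos.2 h0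
  have hQ1 : √q < 1 := by rw [Real.sqrt_lt' one_pos]; simpa using h1
  have hw : 0 < q⁻¹ - q := by
    have := (one_lt_inv₀ h0).2 h1
    linarith
  have hsq : ∀ n : ℤ, √(q ^ n) = √q ^ n := fun n => by
    rw [q_zpow h0, Real.sqrt_sq (zpow_nonneg hQ.le n)]
  have hI : ∀ n, qInt q n = (q ^ (-n) - q ^ n) / (q⁻¹ - q) := fun n => by
    rw [qInt, ← neg_sub (q ^ n), ← neg_sub q, neg_div_neg_eq]
  refine ⟨max √((q⁻¹ - q)⁻¹) (√q)⁻¹, hQ, hQ1, fun e m h h' => ?_, fun n hn => ?_, fun n hn => ?_⟩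
  · rw [DecayBound, abs_of_pos (zpow_pos hQ _), one_mul]
    exact zpow_le_zpow_right_of_le_one₀ hQ hQ1.le h
  · rw [DecayBound, abs_of_nonneg (Real.sqrt_nonneg _)]
    calc √(qInt q n) ≤ √((q⁻¹ - q)⁻¹ * q ^ (-n)) := by
          refine Real.sqrt_le_sqrt ?_
          rw [hI, div_eq_inv_mul]
          gcongr
          have := zpow_pos h0 n
          linarith
      _ = √((q⁻¹ - q)⁻¹) * √q ^ (-n) := by rw [Real.sqrt_mul (by positivity), hsq]
      _ ≤ _ := by
          gcongr
          exact le_max_left _ _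
  · rw [DecayBound, abs_of_nonneg (inv_nonneg.2 (Real.sqrt_nonneg _))]
    rcases hn.eq_or_lt with rfl | hn
    · rw [qInt_zero, Real.sqrt_zero, inv_zero]
      positivity
    · have hle : √q ^ (1 - n) ≤ √(qInt q n) := by
        rw [← hsq]
        refine Real.sqrt_le_sqrt ?_
        have h2 : q ^ n ≤ q ^ (2 - n) :=
          zpow_le_zpow_right_of_le_one₀ h0 h1.le (by omega)
        have e1 : q ^ (-n) = q ^ (1 - n) * q⁻¹ := by
          rw [← zpow_sub_one₀ h0.ne']; congr 1; ring
        have e2 : q ^ (2 - n) = q ^ (1 - n) * q := by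
          rw [← zpow_add_one₀ h0.ne']; congr 1; ring
        rw [hI, le_div_iff₀ hw]
        linarith
      calc (√(qInt q n))⁻¹ ≤ (√q ^ (1 - n))⁻¹ := inv_anti₀ (zpow_pos hQ _) hle
        _ = (√q)⁻¹ * √q ^ n := by
          rw [← zpow_neg, neg_sub, zpow_sub_one₀ hQ.ne', mul_comm]
        _ ≤ _ := by
          gcongr
          exact le_max_right _ _

theorem Growth.exists {q : ℝ} (h0 : 0 < q) (h1 : q ≠ 1) : ∃ τ C, Growth q τ C := by
  rcases lt_or_gt_of_ne h1 with h | h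
  · exact ⟨_, Growth.of_lt_one h0 h⟩
  · obtain ⟨C, hC⟩ := Growth.of_lt_one (inv_pos.2 h0) (inv_lt_one_of_one_lt₀ h)
    refine ⟨_, C, hC.pos, hC.lt_one, fun e m he hm => ?_, fun n hn => ?_, fun n hn => ?_⟩
    · have := hC.zpow (-e) m (by omega) (by omega)
      rwa [Real.sqrt_inv q, inv_zpow', neg_neg, ← Real.sqrt_inv] at this
    · simpa only [qInt_inv] using hC.sqrt n hn
    · simpa only [qInt_inv] using hC.inv_sqrt n hn

section estimates
variable {q τ C : ℝ}

theorem Growth.int (h0 : 0 < q) (h1 : q ≠ 1) (G : Growth q τ C) {n : ℤ} (hn : 0 ≤ n) :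
    DecayBound τ (C * C) (-n + -n) (qInt q n) := by
  rw [← Real.mul_self_sqrt (qInt_nonneg h0 h1 hn)]
  exact (G.sqrt n hn).mul G.pos (G.sqrt n hn)

theorem Growth.inv_int (h0 : 0 < q) (h1 : q ≠ 1) (G : Growth q τ C) {n : ℤ} (hn : 0 ≤ n) :
    DecayBound τ (C * C) (n + n) (qInt q n)⁻¹ := by
  rw [← Real.mul_self_sqrt (qInt_nonneg h0 h1 hn), mul_inv]
  exact (G.inv_sqrt n hn).mul G.pos (G.inv_sqrt n hn)

/-! Each of the following defects of the spectral projection decays exponentially in `N`. The `20` in the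
exponent leaves room for the index shifts; only its independence of `N` matters. -/

theorem exists_bound_diag_up (h0 : 0 < q) (h1 : q ≠ 1) (G : Growth q τ C) (C' : ℝ) :
    ∃ K, ∀ (N i i' : ℤ) (g : ℝ), 0 ≤ i → i ≤ N → i - 1 ≤ i' → i' ≤ i → DecayBound τ C' N g →
      DecayBound τ K (2 * N - 20)
        (wUp q N i g * (projDiag q (N + 1) (i' + 1) - projDiag q N i')) := by
  have p := G.pos
  refine ⟨1 * C * C' * (C * C * (C * C) * (C * C)), fun N i i' g hi hN hi' hi'' hg => ?_⟩
  have e : wUp q N i g * (projDiag q (N + 1) (i' + 1) - projDiag q N i')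
      = √q ^ (i - N + 2 * (N - i')) * √(qInt q (i + 1)) * g
        * (qInt q (N - i') * (qInt q (N + 1))⁻¹ * (qInt q (N + 2))⁻¹) := by
    rw [projDiag_up h0 h1 (by omega), wUp, ← sqrt_zpow_mul h0]
    ring
  rw [e]
  refine ((((G.zpow (i - N + 2 * (N - i')) (i - N + 2 * (N - i')) (by omega) (by omega)).mul p
    (G.sqrt (i + 1) (by omega))).mul p hg).mul p
    (((G.int h0 h1 (show 0 ≤ N - i' by omega)).mul p
    (G.inv_int h0 h1 (show 0 ≤ N + 1 by omega))).mul p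
    (G.inv_int h0 h1 (show 0 ≤ N + 2 by omega)))).mono p G.lt_one.le ?_
  omega

theorem exists_bound_diag_down (h0 : 0 < q) (h1 : q ≠ 1) (G : Growth q τ C) (C' : ℝ) :
    ∃ K, ∀ (N i i' : ℤ) (g : ℝ), 1 ≤ N → 0 ≤ i → i ≤ N → i - 1 ≤ i' → i' ≤ i →
      DecayBound τ C' N g →
      DecayBound τ K (2 * N - 20) (wDown q N i g * (projDiag q (N - 1) i' - projDiag q N i')) := by
  have p := G.pos
  refine ⟨1 * C * C' * (C * C * (C * C) * (C * C)), fun N i i' g h hi hN hi' hi'' hg => ?_⟩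
  have e : wDown q N i g * (projDiag q (N - 1) i' - projDiag q N i')
      = √q ^ (i + 2 * (-i' - 1)) * √(qInt q (N - i)) * g
        * (qInt q (i' + 1) * (qInt q N)⁻¹ * (qInt q (N + 1))⁻¹) := by
    rw [projDiag_down h0 h1 h, wDown, ← sqrt_zpow_mul h0]
    ring
  rw [e]
  refine ((((G.zpow (i + 2 * (-i' - 1)) (2 * (i' + 1) - i) (by omega) (by omega)).mul p
    (G.sqrt (N - i) (by omega))).mul p hg).mul p
    (((G.int h0 h1 (show 0 ≤ i' + 1 by omega)).mul p
    (G.inv_int h0 h1 (show 0 ≤ N by omega))).mul p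
    (G.inv_int h0 h1 (show 0 ≤ N + 1 by omega)))).mono p G.lt_one.le ?_
  omega

theorem exists_bound_plus_up (h0 : 0 < q) (h1 : q ≠ 1) (G : Growth q τ C) (C' : ℝ) :
    ∃ K, ∀ (N i : ℤ) (g : ℝ), 0 ≤ i → i ≤ N → DecayBound τ C' N g →
      DecayBound τ K (2 * N - 20)
        (wUp q N i g * projOff q (N + 1) (i + 1) - projOff q N i * wUp q N (i + 1) g) := by
  have p := G.pos
  refine ⟨1 * C * C * C * (C * C) * (C * C) * C', fun N i g hi hN hg => ?_⟩
  rw [off_plus_up h0 h1 (by omega)]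
  refine (((((((G.zpow (2 * N - i + 2) (2 * N - i + 2) (by omega) (by omega)).mul p
    (G.sqrt (N - i) (by omega))).mul p (G.sqrt (i + 1) (by omega))).mul p
    (G.sqrt (i + 2) (by omega))).mul p (G.inv_int h0 h1 (show 0 ≤ N + 1 by omega))).mul p
    (G.inv_int h0 h1 (show 0 ≤ N + 2 by omega))).mul p hg).neg.mono p G.lt_one.le ?_
  omega

theorem exists_bound_plus_down (h0 : 0 < q) (h1 : q ≠ 1) (G : Growth q τ C) (C' : ℝ) :
    ∃ K, ∀ (N i : ℤ) (g : ℝ), 0 ≤ i → i + 1 ≤ N → DecayBound τ C' N g →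
      DecayBound τ K (2 * N - 20)
        (wDown q N i g * projOff q (N - 1) i - projOff q N i * wDown q N (i + 1) g) := by
  have p := G.pos
  refine ⟨1 * C * C * C * (C * C) * (C * C) * C', fun N i g hi hN hg => ?_⟩
  rw [off_plus_down h0 h1 (by omega)]
  refine (((((((G.zpow (-N - i - 2) (N + i + 2) (by omega) (by omega)).mul p
    (G.sqrt (N - i) (by omega))).mul p (G.sqrt (N - i - 1) (by omega))).mul p
    (G.sqrt (i + 1) (by omega))).mul p (G.inv_int h0 h1 (show 0 ≤ N by omega))).mul p
    (G.inv_int h0 h1 (show 0 ≤ N + 1 by omega))).mul p hg).mono p G.lt_one.le ?_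
  omega

theorem exists_bound_minus_up (h0 : 0 < q) (h1 : q ≠ 1) (G : Growth q τ C) (C' : ℝ) :
    ∃ K, ∀ (N i : ℤ) (g : ℝ), 0 ≤ i → i ≤ N → DecayBound τ C' N g →
      DecayBound τ K (2 * N - 20)
        (wUp q N i g * projOff q (N + 1) i - projOff q N (i - 1) * wUp q N (i - 1) g) := by
  have p := G.pos
  refine ⟨1 * C * (C * C) * (C * C) * (C * C) * C', fun N i g hi hN hg => ?_⟩
  rw [off_minus_up h0 h1 (by omega) hi]
  refine ((((((G.zpow (-i) i (by omega) (by omega)).mul p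
    (G.sqrt (N - i + 1) (by omega))).mul p (G.int h0 h1 (show 0 ≤ N - i + 1 by omega))).mul p
    (G.inv_int h0 h1 (show 0 ≤ N + 1 by omega))).mul p
    (G.inv_int h0 h1 (show 0 ≤ N + 2 by omega))).mul p hg).mono p G.lt_one.le ?_
  omega

theorem exists_bound_minus_down (h0 : 0 < q) (h1 : q ≠ 1) (G : Growth q τ C) (C' : ℝ) :
    ∃ K, ∀ (N i : ℤ) (g : ℝ), 1 ≤ i → i ≤ N → DecayBound τ C' N g →
      DecayBound τ K (2 * N - 20)
        (wDown q N i g * projOff q (N - 1) (i - 1) - projOff q N (i - 1) * wDown q N (i - 1) g) := by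
  have p := G.pos
  refine ⟨1 * C * (C * C) * (C * C) * (C * C) * C', fun N i g hi hN hg => ?_⟩
  rw [off_minus_down h0 h1 (by omega) hN]
  refine ((((((G.zpow (N - i) (N - i) (by omega) (by omega)).mul p
    (G.sqrt i (by omega))).mul p (G.int h0 h1 (show 0 ≤ i by omega))).mul p
    (G.inv_int h0 h1 (show 0 ≤ N by omega))).mul p
    (G.inv_int h0 h1 (show 0 ≤ N + 1 by omega))).mul p hg).neg.mono p G.lt_one.le ?_
  omega

theorem norm_smul_skt_le {N i r : ℤ} {s : Fin 2} {c B : ℝ} (hB : 0 ≤ B)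
    (h : Lawful N i r → |c| ≤ B) : ‖inclS ((c : ℂ) • skt N i r s)‖ ≤ B := by
  by_cases hl : Lawful N i r
  · rw [map_smul, norm_smul, sbasis_lawful hl, norm_inclS_sbasis, mul_one, Complex.norm_real]
    exact h hl
  · rwa [skt_of_not hl, smul_zero, map_zero, norm_zero]

/-- The commutator of the spectral projection with an operator that shifts `l` by `± 1/2`, with
coefficients of the type occurring in left multiplications, decays exponentially in `l`. -/
theorem exists_bound_commutator (h0 : 0 < q) (h1 : q ≠ 1) (G : Growth q τ C)
    {C' : ℝ} {M : PreHilb →ₗ[ℂ] PreHilb} {g g' : ℤ → ℤ → ℝ} {δ δ' : ℤ}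
    (hM : ∀ N i r s, 0 ≤ r → r ≤ N → M (skt N i r s)
      = (wUp q N i (g N r) : ℂ) • skt (N + 1) (i + 1) (r + δ) s
        + (wDown q N i (g' N r) : ℂ) • skt (N - 1) i (r + δ') s)
    (hg : ∀ N r, 0 ≤ r → r ≤ N → DecayBound τ C' N (g N r))
    (hg' : ∀ N r, 0 ≤ r → r ≤ N → DecayBound τ C' N (g' N r)) :
    ∃ K, ∀ p : Idx × Fin 2, ‖inclS (proj q (M (sbasis p)) - M (proj q (sbasis p)))‖
      ≤ K * τ ^ (2 * p.1.N - 20) := by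
  obtain ⟨K1, b1⟩ := exists_bound_diag_up h0 h1 G C'
  obtain ⟨K2, b2⟩ := exists_bound_diag_down h0 h1 G C'
  obtain ⟨K3, b3⟩ := exists_bound_plus_up h0 h1 G C'
  obtain ⟨K4, b4⟩ := exists_bound_plus_down h0 h1 G C'
  obtain ⟨K5, b5⟩ := exists_bound_minus_up h0 h1 G C'
  obtain ⟨K6, b6⟩ := exists_bound_minus_down h0 h1 G C'
  refine ⟨|K1| + |K2| + (|K3| + |K5|) + (|K4| + |K6|), fun p => ?_⟩
  rw [sbasis_apply]
  obtain ⟨⟨N, i, r, ⟨hi, hiN⟩, ⟨hr, hrN⟩⟩, s⟩ := p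
  have ht : 0 < τ ^ (2 * N - 20) := zpow_pos G.pos _
  have hG := hg N r hr hrN
  have hG' := hg' N r hr hrN
  have step : ∀ {K c : ℝ} {N' i' r' : ℤ} {s' : Fin 2},
      (Lawful N' i' r' → DecayBound τ K (2 * N - 20) c) →
      ‖inclS ((c : ℂ) • skt N' i' r' s')‖ ≤ |K| * τ ^ (2 * N - 20) := fun {K} _ _ _ _ _ h =>
    norm_smul_skt_le (mul_nonneg (abs_nonneg _) ht.le) fun hl =>
      (h hl).trans (mul_le_mul_of_nonneg_right (le_abs_self K) ht.le)
  have four : ∀ {x y z w : PreHilb} {a b c d : ℝ}, ‖inclS x‖ ≤ a → ‖inclS y‖ ≤ b →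
      ‖inclS z‖ ≤ c → ‖inclS w‖ ≤ d → ‖inclS (x + y + z + w)‖ ≤ a + b + c + d :=
    fun hx hy hz hw => by
      rw [map_add, map_add, map_add]
      exact norm_add_le_of_le (norm_add_le_of_le (norm_add_le_of_le hx hy) hz) hw
  have hK3 := mul_nonneg (abs_nonneg K3) ht.le
  have hK4 := mul_nonneg (abs_nonneg K4) ht.le
  have hK5 := mul_nonneg (abs_nonneg K5) ht.le
  have hK6 := mul_nonneg (abs_nonneg K6) ht.le
  dsimp only
  rcases (show s = 0 ∨ s = 1 by omega) with rfl | rfl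
  · have e : proj q (M (skt N i r 0)) - M (proj q (skt N i r 0))
        = ((wUp q N i (g N r) * (projDiag q (N + 1) (i + 1) - projDiag q N i) : ℝ) : ℂ)
            • skt (N + 1) (i + 1) (r + δ) 0
        + ((wDown q N i (g' N r) * (projDiag q (N - 1) i - projDiag q N i) : ℝ) : ℂ)
            • skt (N - 1) i (r + δ') 0
        + ((wUp q N i (g N r) * projOff q (N + 1) (i + 1)
            - projOff q N i * wUp q N (i + 1) (g N r) : ℝ) : ℂ)
            • skt (N + 1) (i + 1 + 1) (r + δ) 1
        + ((wDown q N i (g' N r) * projOff q (N - 1) i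
            - projOff q N i * wDown q N (i + 1) (g' N r) : ℝ) : ℂ)
            • skt (N - 1) (i + 1) (r + δ') 1 := by
      simp only [hM _ _ _ _ hr hrN, proj_skt_plus, map_add, map_smul]
      push_cast
      module
    rw [e]
    -- The lowering terms are bounded only for `1 ≤ N`, which holds if their target is in range.
    refine (four (step (K := K1) fun _ => b1 N i i _ hi hiN (by omega) le_rfl hG)
      (step (K := K2) fun hl => b2 N i i _ ?_ hi hiN (by omega) le_rfl hG')
      (step (K := K3) fun _ => b3 N i _ hi hiN hG)
      (step (K := K4) fun hl => b4 N i _ hi ?_ hG')).trans ?_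
    · have := hl.1; omega
    · have := hl.1; omega
    · linarith
  · have e : proj q (M (skt N i r 1)) - M (proj q (skt N i r 1))
        = ((-(wUp q N i (g N r) * (projDiag q (N + 1) (i - 1 + 1) - projDiag q N (i - 1))) : ℝ) : ℂ)
            • skt (N + 1) (i + 1) (r + δ) 1
        + ((-(wDown q N i (g' N r) * (projDiag q (N - 1) (i - 1) - projDiag q N (i - 1))) : ℝ) : ℂ)
            • skt (N - 1) i (r + δ') 1
        + ((wUp q N i (g N r) * projOff q (N + 1) i
            - projOff q N (i - 1) * wUp q N (i - 1) (g N r) : ℝ) : ℂ)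
            • skt (N + 1) i (r + δ) 0
        + ((wDown q N i (g' N r) * projOff q (N - 1) (i - 1)
            - projOff q N (i - 1) * wDown q N (i - 1) (g' N r) : ℝ) : ℂ)
            • skt (N - 1) (i - 1) (r + δ') 0 := by
      simp only [hM _ _ _ _ hr hrN, proj_skt_minus, map_add, map_smul,
        show i + 1 - 1 = i from add_sub_cancel_right i 1,
        show i - 1 + 1 = i from sub_add_cancel i 1]
      push_cast
      module
    rw [e]
    refine (four (step (K := K1) fun _ => (b1 N i (i - 1) _ hi hiN le_rfl (by omega) hG).neg)
      (step (K := K2) fun hl => (b2 N i (i - 1) _ ?_ hi hiN le_rfl (by omega) hG').neg)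
      (step (K := K5) fun _ => b5 N i _ hi hiN hG)
      (step (K := K6) fun hl => b6 N i _ ?_ hiN hG')).trans ?_
    · have := hl.1; omega
    · have := hl.1; omega
    · linarith

end estimates

/-! ### Summability -/

/-- The coordinates `l + m`, `l - m`, `l + n` of a basis vector. -/
def Idx.toNat (p : Idx) : ℕ × ℕ × ℕ := (p.i.toNat, (p.N - p.i).toNat, p.r.toNat)

theorem Idx.toNat_injective : Function.Injective Idx.toNat := by
  rintro ⟨N, i, r, hi, hr⟩ ⟨N', i', r', hi', hr'⟩ h
  simp only [Idx.toNat, Prod.mk.injEq] at h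
  ext <;> dsimp only <;> omega

instance : Countable Idx := Idx.toNat_injective.countable

instance : Infinite Idx :=
  Infinite.of_injective (fun n : ℕ => (⟨n, 0, 0, by omega, by omega⟩ : Idx)) fun m n h => by
    simpa using congrArg Idx.N h

theorem summable_decay {τ : ℝ} (h0 : 0 < τ) (h1 : τ < 1) :
    Summable fun p : Idx × Fin 2 => τ ^ (2 * p.1.N) := by
  have hg : Summable fun n : ℕ => τ ^ n := summable_geometric_of_lt_one h0.le h1
  have hs : Summable fun k : ℕ × ℕ × ℕ => τ ^ k.1 * (τ ^ k.2.1 * τ ^ k.2.2) :=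
    hg.mul_of_nonneg (hg.mul_of_nonneg hg (fun _ => by positivity) (fun _ => by positivity))
      (fun _ => by positivity) (fun _ => by positivity)
  have hI : Summable fun p : Idx => τ ^ (2 * p.N) := by
    refine Summable.of_nonneg_of_le (fun p => by positivity) (fun p => ?_)
      (hs.comp_injective Idx.toNat_injective)
    simp only [Function.comp_apply, Idx.toNat, ← zpow_natCast, ← zpow_add₀ h0.ne']
    have := p.hi
    have := p.hr
    exact zpow_le_zpow_right_of_le_one₀ h0 h1.le (by omega)
  have hF : Summable fun _ : Fin 2 => (1 : ℝ) := (hasSum_fintype _).summable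
  simpa using hI.mul_of_nonneg hF (fun _ => by positivity) (fun _ => by positivity)

/-- An operator whose values on the basis vectors decay exponentially in `l` is trace class, as the
multiplicities grow polynomially. -/
theorem isTraceClass_of_decay {τ K : ℝ} (h0 : 0 < τ) (h1 : τ < 1) (T : Hilb →L[ℂ] Hilb)
    (h : ∀ p, ‖T (inclS (sbasis p))‖ ≤ K * τ ^ (2 * p.1.N - 20)) : IsTraceClass T := by
  obtain ⟨e⟩ : Nonempty (ℕ ≃ Idx × Fin 2) := nonempty_equiv_of_countable
  refine .of_hilbertBasis e hbasis T ?_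
  refine Summable.of_nonneg_of_le (fun _ => norm_nonneg _) (fun p => ?_)
    ((summable_decay h0 h1).mul_left (K * τ ^ (-20 : ℤ)))
  rw [hbasis_apply, mul_assoc, ← zpow_add₀ h0.ne', add_comm (-20)]
  exact h p

/-! ### Left multiplications by the generators -/

section generators
variable {q τ C : ℝ}

theorem cf_eq (h0 : 0 < q) (h1 : q ≠ 1) {e e1 e2 x y d : ℤ} (he : e1 + e2 = e) (hx : 0 ≤ x)
    (hy : 0 ≤ y) (hd : 0 ≤ d) : cf q e x y d = √q ^ e1 * √(qInt q x)
      * (√q ^ e2 * √(qInt q y) * (√(qInt q d))⁻¹ * (√(qInt q (d + 1)))⁻¹) := by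
  have P := fun n hn => @qInt_nonneg q h0 h1 n hn
  rw [cf, Real.sqrt_div (mul_nonneg (P x hx) (P y hy)), Real.sqrt_mul (P x hx),
    Real.sqrt_mul (P d hd), ← he, zpow_add₀ (Real.sqrt_pos.2 h0).ne', div_eq_mul_inv, mul_inv]
  ring

/-- An operator given by the weights `wUp` and `wDown` on the basis is so for all values of the first
index: a weight vanishes whenever its target, but not its source, is in range. -/
theorem map_skt_of_lawful {M : Pol →ₗ[ℂ] Pol} {g g' : ℤ → ℤ → ℝ} {δ δ' : ℤ}
    (hM : ∀ N i r, Lawful N i r → M (ket N i r)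
      = (wUp q N i (g N r) : ℂ) • ket (N + 1) (i + 1) (r + δ)
        + (wDown q N i (g' N r) : ℂ) • ket (N - 1) i (r + δ')) (N i r : ℤ) (s : Fin 2)
    (hr : 0 ≤ r) (hrN : r ≤ N) : TensorProduct.map M LinearMap.id (skt N i r s)
      = (wUp q N i (g N r) : ℂ) • skt (N + 1) (i + 1) (r + δ) s
        + (wDown q N i (g' N r) : ℂ) • skt (N - 1) i (r + δ') s := by
  by_cases h : Lawful N i r
  · rw [skt, TensorProduct.map_tmul, hM N i r h, TensorProduct.add_tmul, LinearMap.id_apply]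
    rfl
  · rw [skt_of_not h, map_zero, skt_of_not (N := N - 1) (by unfold Lawful at *; omega), smul_zero,
      add_zero]
    by_cases h' : i = -1
    · simp [wUp, h', qInt_zero]
    · rw [skt_of_not (by unfold Lawful at *; omega), smul_zero]

theorem exists_bound_mulA (h0 : 0 < q) (h1 : q ≠ 1) (G : Growth q τ C) :
    ∃ K, ∀ p : Idx × Fin 2, ‖inclS (proj q (TensorProduct.map (mulA q) LinearMap.id (sbasis p))
      - TensorProduct.map (mulA q) LinearMap.id (proj q (sbasis p)))‖
      ≤ K * τ ^ (2 * p.1.N - 20) := by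
  refine exists_bound_commutator h0 h1 G (C' := 1 * C * C * C)
    (g := fun N r => √q ^ (r - N - 1) * √(qInt q (r + 1)) * (√(qInt q (N + 1)))⁻¹
      * (√(qInt q (N + 1 + 1)))⁻¹)
    (g' := fun N r => √q ^ (r + 1) * √(qInt q (N - r)) * (√(qInt q N))⁻¹ * (√(qInt q (N + 1)))⁻¹)
    (δ := 1) (δ' := 0) (map_skt_of_lawful fun N i r h => ?_) (fun N r hr hrN => ?_)
    (fun N r hr hrN => ?_)
  · have e := mulA_ket (q := q) 1 (Or.inr h)
    obtain ⟨⟨hi, hiN⟩, hr, hrN⟩ := h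
    rw [Complex.ofReal_one, one_smul, one_mul, one_mul, aUp, aDn,
      cf_eq h0 h1 (e1 := i - N) (e2 := r - N - 1) (by ring) (by omega) (by omega) (by omega),
      cf_eq h0 h1 (e1 := i) (e2 := r + 1) (by ring) (by omega) (by omega) (by omega)] at e
    rw [e, add_zero, wUp, wDown]
  · refine ((((G.zpow (r - N - 1) (N + 1 - r) (by omega) (by omega)).mul G.pos
      (G.sqrt (r + 1) (by omega))).mul G.pos (G.inv_sqrt (N + 1) (by omega))).mul G.pos
      (G.inv_sqrt (N + 1 + 1) (by omega))).mono G.pos G.lt_one.le ?_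
    omega
  · refine ((((G.zpow (r + 1) (r + 1) (by omega) (by omega)).mul G.pos
      (G.sqrt (N - r) (by omega))).mul G.pos (G.inv_sqrt N (by omega))).mul G.pos
      (G.inv_sqrt (N + 1) (by omega))).mono G.pos G.lt_one.le ?_
    omega

theorem exists_bound_mulB (h0 : 0 < q) (h1 : q ≠ 1) (G : Growth q τ C) :
    ∃ K, ∀ p : Idx × Fin 2, ‖inclS (proj q (TensorProduct.map (mulB q) LinearMap.id (sbasis p))
      - TensorProduct.map (mulB q) LinearMap.id (proj q (sbasis p)))‖
      ≤ K * τ ^ (2 * p.1.N - 20) := by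
  refine exists_bound_commutator h0 h1 G (C' := 1 * C * C * C)
    (g := fun N r => √q ^ (r - 1) * √(qInt q (N - r + 1)) * (√(qInt q (N + 1)))⁻¹
      * (√(qInt q (N + 1 + 1)))⁻¹)
    (g' := fun N r => -(√q ^ (r - N - 1) * √(qInt q r) * (√(qInt q N))⁻¹ * (√(qInt q (N + 1)))⁻¹))
    (δ := 0) (δ' := -1) (map_skt_of_lawful fun N i r h => ?_) (fun N r hr hrN => ?_)
    (fun N r hr hrN => ?_)
  · have e := mulB_ket (q := q) 1 (Or.inr h)
    obtain ⟨⟨hi, hiN⟩, hr, hrN⟩ := h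
    rw [Complex.ofReal_one, one_smul, one_mul, one_mul, bUp, bDn,
      cf_eq h0 h1 (e1 := i - N) (e2 := r - 1) (by ring) (by omega) (by omega) (by omega),
      cf_eq h0 h1 (e1 := i) (e2 := r - N - 1) (by ring) (by omega) (by omega) (by omega)] at e
    rw [e, add_zero, wUp, wDown, mul_neg, sub_eq_add_neg r 1]
  · refine ((((G.zpow (r - 1) (r + 1) (by omega) (by omega)).mul G.pos
      (G.sqrt (N - r + 1) (by omega))).mul G.pos (G.inv_sqrt (N + 1) (by omega))).mul G.pos
      (G.inv_sqrt (N + 1 + 1) (by omega))).mono G.pos G.lt_one.le ?_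
    omega
  · refine ((((G.zpow (r - N - 1) (N + 1 - r) (by omega) (by omega)).mul G.pos
      (G.sqrt r (by omega))).mul G.pos (G.inv_sqrt N (by omega))).mul G.pos
      (G.inv_sqrt (N + 1) (by omega))).neg.mono G.pos G.lt_one.le ?_
    omega

theorem amplify_inclS {T : L2 →L[ℂ] L2} {M : Pol →ₗ[ℂ] Pol} (h : ∀ v, T (incl v) = incl (M v))
    (v : PreHilb) : amplify T (inclS v) = inclS (TensorProduct.map M LinearMap.id v) := by
  induction v using TensorProduct.induction_on with
  | zero => simp
  | add v w hv hw => rw [map_add, map_add, map_add, map_add, hv, hw]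
  | tmul f v =>
    rw [TensorProduct.map_tmul]
    ext1 s
    rw [amplify_apply]
    change T (v s • incl f) = v s • incl (M f)
    rw [map_smul, h]

/-- The commutator of the spectral projection with a left multiplication is trace class as soon as it
decays exponentially in `l` on the algebraic spinor space. -/
theorem isTraceClass_commutator_proj (h0 : 0 < q) (h1 : q ≠ 1) (G : Growth q τ C)
    {T : L2 →L[ℂ] L2} {M : Pol →ₗ[ℂ] Pol} (h : ∀ v, T (incl v) = incl (M v))
    (hK : ∃ K, ∀ p : Idx × Fin 2, ‖inclS (proj q (TensorProduct.map M LinearMap.id (sbasis p))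
      - TensorProduct.map M LinearMap.id (proj q (sbasis p)))‖ ≤ K * τ ^ (2 * p.1.N - 20)) :
    IsTraceClass (calOp q 1 0 * amplify T - amplify T * calOp q 1 0) := by
  obtain ⟨K, hK⟩ := hK
  refine isTraceClass_of_decay G.pos G.lt_one _ (K := K) fun p => ?_
  have hP : ∀ v, calOp q 1 0 (inclS v) = inclS (proj q v) := fun v => by
    rw [calOp_incl h0 h1 (by simp) (by simp), cal_one_zero]
  change ‖calOp q 1 0 (amplify T (inclS (sbasis p))) - amplify T (calOp q 1 0 (inclS (sbasis p)))‖ ≤ _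
  rw [hP, amplify_inclS h, amplify_inclS h, hP, ← map_sub]
  exact hK p

end generators

/-! ### The Fredholm module -/

section fredholm
variable {q τ C : ℝ}

theorem bdd_neg (x : ℝ) : bdd (-x) = -bdd x := by
  rw [bdd, bdd, resolv, resolv, neg_sq, neg_mul]

theorem resolv_sq_qInt_le (h0 : 0 < q) (h1 : q ≠ 1) (G : Growth q τ C) {N n : ℤ} (hN : 0 ≤ N)
    (hn : N ≤ n) : resolv (qInt q n) ^ 2 ≤ (C * C + 1) * τ ^ (2 * N - 20) := by
  have ht : 0 < τ ^ (2 * N - 20) := zpow_pos G.pos _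
  rcases (hN.trans hn).eq_or_lt with rfl | h
  · have h1 : 1 ≤ τ ^ (2 * N - 20) := by
      rw [← zpow_zero τ]
      exact zpow_le_zpow_right_of_le_one₀ G.pos G.lt_one.le (by omega)
    have h2 := resolv_pos (qInt q 0)
    have h3 := resolv_le_one (qInt q 0)
    nlinarith [mul_nonneg (mul_self_nonneg C) ht.le]
  · have hp := qInt_pos h0 h1 h
    have hd := (G.inv_int h0 h1 h.le).mono G.pos G.lt_one.le (k' := 2 * N - 20) (by omega)
    rw [DecayBound, abs_of_pos (inv_pos.2 hp)] at hd
    have hr : resolv (qInt q n) ^ 2 ≤ (qInt q n)⁻¹ := by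
      rw [← one_div, le_div_iff₀ hp]
      have h2 := resolv_sq (qInt q n)
      nlinarith [mul_nonneg (sq_nonneg (resolv (qInt q n))) (sq_nonneg (qInt q n - 1)),
        mul_nonneg (sq_nonneg (resolv (qInt q n))) hp.le, sq_nonneg (resolv (qInt q n))]
    linarith

theorem abs_bdd_sub_one_le {x : ℝ} (hx : 0 ≤ x) : |bdd x - 1| ≤ resolv x ^ 2 := by
  have h0 : 0 ≤ bdd x := mul_nonneg hx (resolv_pos x).le
  have h1 := (le_abs_self _).trans (abs_bdd_le_one x)
  rw [abs_of_nonpos (by linarith), ← one_sub_bdd_sq]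
  nlinarith

/-- An operator of the functional calculus is trace class if its two functions are dominated by
`(1 + D²)⁻¹`. -/
theorem isTraceClass_of_cal (h0 : 0 < q) (h1 : q ≠ 1) (G : Growth q τ C) {T : Hilb →L[ℂ] Hilb}
    {φ ψ : ℤ → ℝ} (hT : ∀ v, T (inclS v) = inclS (cal q φ ψ v))
    (hφ : ∀ N, 0 ≤ N → |φ N| ≤ resolv (qInt q N) ^ 2)
    (hψ : ∀ N, 0 ≤ N → |ψ N| ≤ resolv (qInt q (N + 2)) ^ 2) : IsTraceClass T := by
  refine isTraceClass_of_decay G.pos G.lt_one T (K := (C * C + 1) + (C * C + 1)) fun p => ?_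
  have hN : 0 ≤ p.1.N := p.1.hi.1.trans p.1.hi.2
  rw [hT, add_mul]
  exact (norm_cal_sbasis_le h0 h1 φ ψ p).trans (add_le_add
    ((hφ _ hN).trans (resolv_sq_qInt_le h0 h1 G hN le_rfl))
    ((hψ _ hN).trans (resolv_sq_qInt_le h0 h1 G hN (by omega))))

theorem isTraceClass_diracF_sq_sub_one (h0 : 0 < q) (h1 : q ≠ 1) (G : Growth q τ C) :
    IsTraceClass (diracF q * diracF q - 1) := by
  have hb : ∀ x, |bdd x * bdd x + -1| ≤ resolv x ^ 2 := fun x => by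
    rw [show bdd x * bdd x + -1 = -(1 - bdd x ^ 2) by ring, one_sub_bdd_sq, abs_neg,
      abs_of_nonneg (sq_nonneg _)]
  refine isTraceClass_of_cal h0 h1 G
    (φ := fun N => bdd (qInt q N) * bdd (qInt q N) + -1)
    (ψ := fun N => bdd (-qInt q (N + 2)) * bdd (-qInt q (N + 2)) + -1) (fun v => ?_)
    (fun N _ => hb _) (fun N _ => ?_)
  · have e := LinearMap.congr_fun (cal_add (q := q)
      (fun N => bdd (qInt q N) * bdd (qInt q N) + -1)
      (fun N => bdd (-qInt q (N + 2)) * bdd (-qInt q (N + 2)) + -1) 1 1) v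
    have hF : ∀ v, diracF q (inclS v) = _ := fun v =>
      calOp_incl h0 h1 (fun _ => abs_bdd_le_one _) (fun _ => abs_bdd_le_one _) v
    change diracF q (diracF q (inclS v)) - inclS v = _
    rw [hF, hF, ← Module.End.mul_apply, cal_mul h0 h1, sub_eq_iff_eq_add, ← map_add]
    rw [cal_one] at e
    refine congrArg inclS (Eq.trans ?_ e.symm)
    congr 2 <;> ext n <;> simp
  · refine (hb _).trans (le_of_eq ?_)
    rw [resolv, resolv, neg_sq]

/-- Up to a trace class operator, `F` is the sign `2 P - 1` of the Dirac operator. -/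
theorem isTraceClass_diracF_sub_sign (h0 : 0 < q) (h1 : q ≠ 1) (G : Growth q τ C) :
    IsTraceClass (diracF q - (calOp q 1 0 + calOp q 1 0 - 1)) := by
  refine isTraceClass_of_cal h0 h1 G
    (φ := fun N => bdd (qInt q N) - 1) (ψ := fun N => bdd (-qInt q (N + 2)) + 1) (fun v => ?_)
    (fun N hN => abs_bdd_sub_one_le (qInt_nonneg h0 h1 hN)) (fun N hN => ?_)
  · have hF : diracF q (inclS v) = _ :=
      calOp_incl h0 h1 (fun _ => abs_bdd_le_one _) (fun _ => abs_bdd_le_one _) v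
    have hP : calOp q 1 0 (inclS v) = _ := calOp_incl h0 h1 (by simp) (by simp) v
    have e1 := LinearMap.congr_fun (cal_add (q := q) 1 0 1 0) v
    have e2 := LinearMap.congr_fun (cal_add (q := q) (fun N => bdd (qInt q N) - 1)
      (fun N => bdd (-qInt q (N + 2)) + 1) (1 + 1) (0 + 0)) v
    have e3 := LinearMap.congr_fun (cal_add (q := q) (fun N => bdd (qInt q N))
      (fun N => bdd (-qInt q (N + 2))) 1 1) v
    rw [LinearMap.add_apply] at e1 e2 e3
    rw [cal_one] at e3
    change diracF q (inclS v) - (calOp q 1 0 (inclS v) + calOp q 1 0 (inclS v) - inclS v) = _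
    rw [hF, hP, ← map_add, ← map_sub, ← map_sub, e1]
    congr 1
    rw [sub_sub_eq_add_sub, sub_eq_iff_eq_add, e2]
    refine e3.trans ?_
    congr 2 <;> ext n <;> simp
  · rw [bdd_neg, neg_add_eq_sub, abs_sub_comm]
    exact abs_bdd_sub_one_le (qInt_nonneg h0 h1 (by omega))

theorem isTraceClass_commutator_of_proj (h0 : 0 < q) (h1 : q ≠ 1) (G : Growth q τ C)
    {T : Hilb →L[ℂ] Hilb} (h : IsTraceClass (calOp q 1 0 * T - T * calOp q 1 0)) :
    IsTraceClass (diracF q * T - T * diracF q) := by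
  have hE := isTraceClass_diracF_sub_sign h0 h1 G
  have e : diracF q * T - T * diracF q
      = (diracF q - (calOp q 1 0 + calOp q 1 0 - 1)) * T
        - T * (diracF q - (calOp q 1 0 + calOp q 1 0 - 1))
        + ((calOp q 1 0 * T - T * calOp q 1 0) + (calOp q 1 0 * T - T * calOp q 1 0)) := by
    simp only [sub_mul, mul_sub, add_mul, mul_add, one_mul, mul_one]
    abel
  rw [e]
  exact ((hE.comp_right T).sub (hE.comp_left T)).add (h.add h)

theorem diracF_isSelfAdjoint (h0 : 0 < q) (h1 : q ≠ 1) : IsSelfAdjoint (diracF q) :=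
  calOp_isSelfAdjoint h0 h1 (fun _ => abs_bdd_le_one _) (fun _ => abs_bdd_le_one _)

theorem isTraceClass_commutator_star {F T : Hilb →L[ℂ] Hilb} (hF : IsSelfAdjoint F)
    (h : IsTraceClass (F * T - T * F)) : IsTraceClass (F * star T - star T * F) := by
  have := h.star.neg
  rwa [star_sub, star_mul, star_mul, hF.star_eq, neg_sub] at this

theorem spinorRep_gen (h0 : 0 < q) (h1 : q ≠ 1) (x : Gen) :
    spinorRep h0 h1 (gen q x) = amplify (opGen q x) :=
  congrArg amplify (regularHom_gen h0 h1 x)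

theorem isTraceClass_commutator (h0 : 0 < q) (h1 : q ≠ 1) (x : Alg q) :
    IsTraceClass (diracF q * spinorRep h0 h1 x - spinorRep h0 h1 x * diracF q) := by
  obtain ⟨τ, C, G⟩ := Growth.exists h0 h1
  have hsa := diracF_isSelfAdjoint h0 h1
  have ha := isTraceClass_commutator_of_proj h0 h1 G
    (isTraceClass_commutator_proj h0 h1 G (opA_incl h0 h1) (exists_bound_mulA h0 h1 G))
  have hb := isTraceClass_commutator_of_proj h0 h1 G
    (isTraceClass_commutator_proj h0 h1 G (opB_incl h0 h1) (exists_bound_mulB h0 h1 G))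
  induction x using alg_induction with
  | h1 =>
    rw [map_one, mul_one, one_mul, sub_self]
    simpa using ha.smul 0
  | hg g =>
    rw [spinorRep_gen]
    cases g with
    | a => exact ha
    | b => exact hb
    | aStar =>
      rw [opGen, map_star]
      exact isTraceClass_commutator_star hsa ha
    | bStar =>
      rw [opGen, map_star]
      exact isTraceClass_commutator_star hsa hb
  | hs c x h => simpa only [map_smul, mul_smul_comm, smul_mul_assoc, smul_sub] using h.smul c
  | hm x y hx hy =>
    have e : ∀ F X Y : Hilb →L[ℂ] Hilb, F * (X * Y) - X * Y * F
        = (F * X - X * F) * Y + X * (F * Y - Y * F) := fun F X Y => by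
      simp only [sub_mul, mul_sub, mul_assoc, sub_add_sub_cancel]
    rw [map_mul, e]
    exact (hx.comp_right _).add (hy.comp_left _)
  | ha x y hx hy =>
    have e : ∀ F X Y : Hilb →L[ℂ] Hilb, F * (X + Y) - (X + Y) * F
        = (F * X - X * F) + (F * Y - Y * F) := fun F X Y => by
      rw [mul_add, add_mul, add_sub_add_comm]
    rw [map_add, e]
    exact hx.add hy

end fredholm

end SUq2

theorem mainTheorem4 (q : ℝ) (h0 : 0 < q) (h1 : q ≠ 1) :
    ∃ F : SUq2.Hilb →L[ℂ] SUq2.Hilb,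
      (∀ F' : SUq2.Hilb →L[ℂ] SUq2.Hilb,
        SUq2.IsBoundedTransform SUq2.inclS (SUq2.dirac q) F' ↔ F' = F) ∧
      SUq2.IsOneSummableFredholmModule (SUq2.spinorRep h0 h1) F := by
  obtain ⟨τ, C, G⟩ := SUq2.Growth.exists h0 h1
  exact ⟨SUq2.diracF q, SUq2.isBoundedTransform_dirac_iff h0 h1,
    SUq2.diracF_isSelfAdjoint h0 h1, SUq2.isTraceClass_diracF_sq_sub_one h0 h1 G,
    SUq2.isTraceClass_commutator h0 h1⟩
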